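/- Let $V=\mathbb C t_0\oplus\mathbb C t_1$, let $P(r)=\mathbb P\,\mathrm{Sym}^r(V)$ be the projective space of binary forms of degree $r$, whose points are identified with effective divisors of degree $r$ on $P(1)\cong\mathbb P^1$ (products of linear forms), and let $X_r=\{r\,p : p\in P(1)\}\subset P(r)$ be the Veronese curve. On $\mathrm{Sym}^4(V)$ use the coordinates $a_0,\dots,a_4$ given by $F=\sum_{i=0}^4\binom4i a_i t_0^{4-i}t_1^i$, and put $$Q=a_0a_4-4a_1a_3+3a_2^2,\qquad C=a_0a_2a_4-a_0a_3^2+2a_1a_2a_3-a_1^2a_4-a_2^3,\qquad \omega=3C\,dQ-2Q\,dC,$$ so that $\omega$ defines the foliation of $P(4)\cong\mathbb P^4$ by the fibres of $Q^3/C^2$. For a homogeneous polynomial 1-form $\eta$ on a projective space, let $S(\eta)$ be its set of zeros and $S_k(\eta)$ the union of the irreducible components of $S(\eta)$ of dimension $k$. If $\eta\neq0$, let $\bar\eta=\eta/F$, where $F$ is a homogeneous polynomial of maximal degree dividing all coefficients of $\eta$ ($\bar\eta$ is determined up to a nonzero constant). **Proposition.** Let $p\in P(1)$, and let $\mathbb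 P^k_p\subset P(4)$ be the osculating $k$-plane of $X_4$ at the point $4p$, for $k=1,2,3$; put $H=\mathbb P^3_p$. Then $\mathbb P^k_p$ is a linear subspace of dimension $k$, and $$\mathbb P^1_p=\{3p+q\},\qquad \mathbb P^2_p=\{2p+q+r\},\qquad H=\{p+q+r+s\}\qquad(q,r,s\in P(1)).$$ The set $X_2^p=\{2p+2q: q\in P(1)\}\subset\mathbb P^2_p$ is a conic (the image of the Veronese curve $X_2$ under a linear isomorphism $P(2)\cong\mathbb P^2_p$), and $X_3^p=\{p+3q: q\in P(1)\}\subset H$ is a twisted cubic (the image of the Veronese curve $X_3$ under a linear isomorphism $P(3)\cong H$). Let $\omega_H$ be the restriction of $\omega$ to $H$, written in any system of linear coordinates on $H\cong\mathbb P^3$. Then: 1. $S_2(\omega_H)=\mathbb P^2_p$. 2. $\bar\omega_H=\omega_H/F$ exists, and for every choice of $F$: $F$ is a linear form, its zero set in $H$ is $\mathbb P^2_p$, and $$S(\bar\omega_H)=S_1(\bar\omega_H)=\mathbb P^1_p\cup X_2^p\cup X_3^p .$$ 3. $\bar\omega_H$ defines a codimension one foliation of degree two on $H\cong\mathbb P^3$: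 it is nonzero, its coefficients are homogeneous of degree $3$, its contraction with the radial vector field is zero, $\bar\omega_H\wedge d\bar\omega_H=0$, and it has no zeros in codimension one. 4. This foliation is the exceptional one: in suitable linear coordinates $x_0,\dots,x_3$ on $H$, and up to a nonzero constant factor, $\bar\omega_H$ equals $$x_3\big[(2x_1^2-3x_0x_2)\,dx_0+(3x_2x_3-x_0x_1)\,dx_1+(x_0^2-2x_1x_3)\,dx_2\big]-(x_0x_1^2-2x_0^2x_2+x_1x_2x_3)\,dx_3 .$$ -/

import Mathlib

open scoped LinearAlgebra.Projectivization

namespace QuarticFoliation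

noncomputable section

/-! ### Binary forms and divisors on the projective line -/

/-- `Sym^r(V)`, for `V = ℂ t₀ ⊕ ℂ t₁`: binary forms of degree `r` in `t₀ = X 0`, `t₁ = X 1`. -/
abbrev BinForm (r : ℕ) : Type :=
  ↥(MvPolynomial.homogeneousSubmodule (Fin 2) ℂ r)

/-- `P(r) = ℙ Sym^r(V)`. In particular `P(1) = ℙ V` is the projective line. -/
abbrev PForm (r : ℕ) : Type := ℙ ℂ (BinForm r)

/-- The product of the linear forms representing `q 0, …, q (r - 1)`. -/
def divisorForm {r : ℕ} (q : Fin r → PForm 1) : BinForm r :=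
  ⟨∏ i, ((q i).rep : MvPolynomial (Fin 2) ℂ), by
    have h := MvPolynomial.IsHomogeneous.prod Finset.univ
      (fun i => ((q i).rep : MvPolynomial (Fin 2) ℂ)) (fun _ => 1)
      (fun i _ => (MvPolynomial.mem_homogeneousSubmodule 1 _).1 (q i).rep.2)
    simpa using h⟩

theorem divisorForm_ne_zero {r : ℕ} (q : Fin r → PForm 1) : divisorForm q ≠ 0 := by
  intro h
  have h' : ∏ i, ((q i).rep : MvPolynomial (Fin 2) ℂ) = 0 := congrArg Subtype.val h
  obtain ⟨i, -, hi⟩ := Finset.prod_eq_zero_iff.1 h'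
  exact (q i).rep_nonzero (Subtype.ext hi)

/-- The effective divisor `q 0 + ⋯ + q (r - 1)` of degree `r` on `P(1)`, as a point of `P(r)`. -/
def divisor {r : ℕ} (q : Fin r → PForm 1) : PForm r :=
  Projectivization.mk ℂ (divisorForm q) (divisorForm_ne_zero q)

/-- The Veronese curve `X_r ⊆ P(r)`, the image of `v ↦ v ^ r`. -/
def veroneseCurve (r : ℕ) : Set (PForm r) :=
  Set.range fun p : PForm 1 => divisor fun _ : Fin r => p

/-- The linear space underlying the osculating `k`-plane of `X_r` at `v ^ r`, `p = [v]`: it is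
spanned by the Taylor coefficients of orders `0, …, k` at `s = 0` of the parametrizations
`s ↦ (v + s w) ^ r`, `w ∈ V`, of the curve. -/
def osculatingSpace (r k : ℕ) (p : PForm 1) : Submodule ℂ (BinForm r) :=
  Submodule.span ℂ {F | ∃ w : BinForm 1, ∃ j ≤ k,
    (F : MvPolynomial (Fin 2) ℂ) =
      ((Polynomial.C (p.rep : MvPolynomial (Fin 2) ℂ) +
        Polynomial.C (w : MvPolynomial (Fin 2) ℂ) * Polynomial.X) ^ r).coeff j}

/-- The osculating `k`-plane of `X_r` at the point `r p`, as a subset of `P(r)`. -/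
def osculatingPlane (r k : ℕ) (p : PForm 1) : Set (PForm r) :=
  {x | x.rep ∈ osculatingSpace r k p}

/-- `X_2 = {2p + 2q}`. -/
def conicAt (p : PForm 1) : Set (PForm 4) :=
  {x | ∃ q, x = divisor ![p, p, q, q]}

/-- `X_3 = {p + 3q}`. -/
def cubicAt (p : PForm 1) : Set (PForm 4) :=
  {x | ∃ q, x = divisor ![p, q, q, q]}

/-! ### Polynomial 1-forms -/

/-- The polynomial 1-form `∑ i, a_i dx_i` on `ℂ^n`, given by its coefficients. -/
abbrev OneForm (n : ℕ) : Type := Fin n → MvPolynomial (Fin n) ℂ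

/-- The differential of a polynomial. -/
def differential {n : ℕ} (f : MvPolynomial (Fin n) ℂ) : OneForm n :=
  fun i => MvPolynomial.pderiv i f

/-- The `i`-th component of a linear map `ℂ^m → ℂ^n`, as a linear polynomial. -/
def linearComponent {m n : ℕ} (L : (Fin m → ℂ) →ₗ[ℂ] (Fin n → ℂ)) (i : Fin n) :
    MvPolynomial (Fin m) ℂ :=
  ∑ j, MvPolynomial.C (L (Pi.single j 1) i) * MvPolynomial.X j

/-- The pull-back `∑ i, (a_i ∘ L) d(x_i ∘ L)` of `∑ i, a_i dx_i` along a linear map `L`. -/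
def pullback {m n : ℕ} (L : (Fin m → ℂ) →ₗ[ℂ] (Fin n → ℂ)) (ω : OneForm n) : OneForm m :=
  ∑ i, MvPolynomial.aeval (linearComponent L) (ω i) • differential (linearComponent L i)

/-! ### Algebraic subsets of projective space -/

/-- The zeros in `ℙ^{n-1}` of a set of polynomials (used for homogeneous ones). -/
def projZeros {n : ℕ} (S : Set (MvPolynomial (Fin n) ℂ)) : Set (ℙ ℂ (Fin n → ℂ)) :=
  {x | ∀ f ∈ S, MvPolynomial.eval x.rep f = 0}

/-- Zariski closed subsets of `ℙ^{n-1}`. -/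
def IsAlgebraic {n : ℕ} (Z : Set (ℙ ℂ (Fin n → ℂ))) : Prop :=
  ∃ S : Set (MvPolynomial (Fin n) ℂ), (∀ f ∈ S, ∃ d, f.IsHomogeneous d) ∧ Z = projZeros S

/-- Irreducible Zariski closed subsets. -/
def IsIrreducibleAlgebraic {n : ℕ} (Z : Set (ℙ ℂ (Fin n → ℂ))) : Prop :=
  IsAlgebraic Z ∧ Z.Nonempty ∧
    ∀ A B, IsAlgebraic A → IsAlgebraic B → Z ⊆ A ∪ B → Z ⊆ A ∨ Z ⊆ B

/-- `Z` is an irreducible component of the Zariski closed set `S`. -/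
def IsIrredComponent {n : ℕ} (Z S : Set (ℙ ℂ (Fin n → ℂ))) : Prop :=
  IsIrreducibleAlgebraic Z ∧ Z ⊆ S ∧
    ∀ Z', IsIrreducibleAlgebraic Z' → Z ⊆ Z' → Z' ⊆ S → Z' = Z

/-- The affine cone over `Z`, without the origin. -/
def cone {n : ℕ} (Z : Set (ℙ ℂ (Fin n → ℂ))) : Set (Fin n → ℂ) :=
  {v | ∃ hv : v ≠ 0, Projectivization.mk ℂ v hv ∈ Z}

/-- `Z` has dimension `k`: its homogeneous coordinate ring has Krull dimension `k + 1`. -/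
def HasDim {n : ℕ} (Z : Set (ℙ ℂ (Fin n → ℂ))) (k : ℕ) : Prop :=
  ringKrullDim (MvPolynomial (Fin n) ℂ ⧸ MvPolynomial.vanishingIdeal ℂ (cone Z)) =
    ((k + 1 : ℕ) : WithBot ℕ∞)

/-- `S(ω)`: the zeros of `ω` in projective space. -/
def formZeros {n : ℕ} (ω : OneForm n) : Set (ℙ ℂ (Fin n → ℂ)) := projZeros (Set.range ω)

/-- `S_k(ω)`: the union of the irreducible components of dimension `k` of `S(ω)`. -/
def formZerosOfDim {n : ℕ} (k : ℕ) (ω : OneForm n) : Set (ℙ ℂ (Fin n → ℂ)) :=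
  ⋃₀ {Z | IsIrredComponent Z (formZeros ω) ∧ HasDim Z k}

/-! ### Foliations -/

/-- `F` is a homogeneous polynomial of maximal degree dividing `ω`, and `η = ω / F`. -/
def IsReduction {n : ℕ} (ω : OneForm n) (F : MvPolynomial (Fin n) ℂ) (η : OneForm n) : Prop :=
  ∃ e, F.IsHomogeneous e ∧ F ≠ 0 ∧ (∀ i, ω i = F * η i) ∧
    ∀ (G : MvPolynomial (Fin n) ℂ) (e' : ℕ), G.IsHomogeneous e' → G ≠ 0 →
      (∀ i, G ∣ ω i) → e' ≤ e

/-- The integrability condition `ω ∧ dω = 0`, written on coefficients. -/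
def IsIntegrable {n : ℕ} (ω : OneForm n) : Prop :=
  ∀ i j k,
    ω i * (MvPolynomial.pderiv j (ω k) - MvPolynomial.pderiv k (ω j)) +
    ω j * (MvPolynomial.pderiv k (ω i) - MvPolynomial.pderiv i (ω k)) +
    ω k * (MvPolynomial.pderiv i (ω j) - MvPolynomial.pderiv j (ω i)) = 0

/-- `ω ≠ 0` is an integrable section of `Ω¹(d + 2)` on `ℙ^r`, without zeros in codimension one:
it defines a codimension one foliation of degree `d` on `ℙ^r`. -/
structure DefinesFoliation (r d : ℕ) (ω : OneForm (r + 1)) : Prop where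
  ne_zero : ω ≠ 0
  homogeneous : ∀ i, (ω i).IsHomogeneous (d + 1)
  radial : ∑ i, ω i * MvPolynomial.X i = 0
  integrable : IsIntegrable ω
  codim_two : ∀ k, k + 1 = r → formZerosOfDim k ω = ∅

open MvPolynomial in
/-- The standard form of the exceptional foliation of degree two on `ℙ³`. -/
def exceptionalForm : OneForm 4 :=
  ![X 3 * (2 * X 1 ^ 2 - 3 * X 0 * X 2),
    X 3 * (3 * X 2 * X 3 - X 0 * X 1),
    X 3 * (X 0 ^ 2 - 2 * X 1 * X 3),
    -(X 0 * X 1 ^ 2 - 2 * X 0 ^ 2 * X 2 + X 1 * X 2 * X 3)]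

/-- `η` defines the exceptional foliation: up to a nonzero constant it becomes the standard form
in suitable linear coordinates. -/
def IsExceptional (η : OneForm 4) : Prop :=
  ∃ (g : (Fin 4 → ℂ) ≃ₗ[ℂ] (Fin 4 → ℂ)) (c : ℂ), c ≠ 0 ∧
    pullback (g : (Fin 4 → ℂ) →ₗ[ℂ] (Fin 4 → ℂ)) η = c • exceptionalForm

/-! ### The foliation on the space of binary quartics -/

/-- The coordinates `a_0, …, a_4` on `Sym⁴(V)`: they are normalized by
`F = ∑ i, (4 choose i) a_i t₀^(4-i) t₁^i`. -/
def quarticCoords : BinForm 4 →ₗ[ℂ] (Fin 5 → ℂ) :=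
  LinearMap.pi fun i : Fin 5 =>
    ((Nat.choose 4 i : ℂ)⁻¹) •
      (MvPolynomial.lcoeff ℂ (Finsupp.single 0 (4 - (i : ℕ)) + Finsupp.single 1 (i : ℕ))).comp
        (MvPolynomial.homogeneousSubmodule (Fin 2) ℂ 4).subtype

open MvPolynomial in
/-- The invariant quadric `Q = a₀a₄ - 4a₁a₃ + 3a₂²`. -/
def invQ : MvPolynomial (Fin 5) ℂ := X 0 * X 4 - 4 * X 1 * X 3 + 3 * X 2 ^ 2

open MvPolynomial in
/-- The catalecticant `C = a₀a₂a₄ - a₀a₃² + 2a₁a₂a₃ - a₁²a₄ - a₂³`. -/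
def invC : MvPolynomial (Fin 5) ℂ :=
  X 0 * X 2 * X 4 - X 0 * X 3 ^ 2 + 2 * X 1 * X 2 * X 3 - X 1 ^ 2 * X 4 - X 2 ^ 3

/-- The 1-form `ω = 3 C dQ - 2 Q dC`, defining the foliation by the fibres of `Q³ / C²`. -/
def omega : OneForm 5 := (3 * invC) • differential invQ - (2 * invQ) • differential invC

end

end QuarticFoliation

open QuarticFoliation

namespace QuarticFoliation

noncomputable section

open MvPolynomial

/-! Complete a representative `v` of `p` to a basis `v, w` of `V` of determinant one. The quartics
in `H` are the multiples of `v`, written `b₀v⁴ + 4b₁v³w + 6b₂v²w² + 4b₃vw³`. Since `Q` and `C` are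
invariant under unimodular substitutions, they restrict to `3b₂² - 4b₁b₃` and `2b₁b₂b₃ - b₀b₃² -
b₂³`. With `b₀ = 3y₂`, `b₁ = (3/2)y₁`, `b₂ = y₀`, `b₃ = y₃`, a direct computation gives `3C dQ - 2Q
dC = 18 y₃ · exceptionalForm` (`pencilForm_restricted`, `pullback_omega`). Any other linear
coordinates on `H` differ from `y` by an automorphism `g` of `ℂ⁴`, and pull-back is functorial, so
all claims reduce to the standard form.

The plane `y₃ = 0` is `{2p+q+r}`. The coefficients of the standard form have no common factor
(`isUnit_of_dvd_exceptionalForm`), so every reduction divides by a constant multiple of `y₃ ∘ g`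
(`IsReduction.eq_planeForm`). The zeros of the standard form are a line, a conic and a twisted cubic
(`eval_exceptionalForm_eq_zero_iff`), parametrized by the forms `v^(3-i) (s₀v + s₁w)^(i+1)` up to
constants, that is by the divisors `(3-i)p + (i+1)q` (`exists_frameMap_eq_iff`).

Irreducibility and dimension come from the parametrizations: the homogeneous coordinate ring of the
image is the subring generated by the coordinate forms of the parametrization, which is a domain
over which the full polynomial ring in the parameters is integral (`vanishingIdeal_cone_paramSet`,
`hasDim_paramSet`). Integrability and the vanishing of the radial contraction hold for every form
`3f dg - 2g df` of the relevant degrees and survive division by a common factor. -/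

/-! ### Linear substitutions and pull-backs -/

/-- Composition of polynomials with a linear map. -/
def subst {m n : ℕ} (L : (Fin m → ℂ) →ₗ[ℂ] (Fin n → ℂ)) :
    MvPolynomial (Fin n) ℂ →ₐ[ℂ] MvPolynomial (Fin m) ℂ :=
  aeval (linearComponent L)

theorem eval_linearComponent {m n : ℕ} (L : (Fin m → ℂ) →ₗ[ℂ] (Fin n → ℂ)) (i : Fin n)
    (x : Fin m → ℂ) : eval x (linearComponent L i) = L x i := by
  conv_rhs => rw [← Finset.univ_sum_single x]
  simp only [map_sum, Finset.sum_apply, linearComponent, map_mul, eval_C, eval_X]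
  refine Finset.sum_congr rfl fun j _ => ?_
  rw [show Pi.single j (x j) = x j • (Pi.single j 1 : Fin m → ℂ) by simp [← Pi.single_smul],
    map_smul, Pi.smul_apply, smul_eq_mul, mul_comm]

theorem eval_subst {m n : ℕ} (L : (Fin m → ℂ) →ₗ[ℂ] (Fin n → ℂ)) (f : MvPolynomial (Fin n) ℂ)
    (x : Fin m → ℂ) : eval x (subst L f) = eval (L x) f := by
  induction f using MvPolynomial.induction_on with
  | C a => rw [subst, aeval_C, algebraMap_eq, eval_C, eval_C]
  | add p q hp hq => rw [map_add, map_add, map_add, hp, hq]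
  | mul_X p i hp =>
    rw [map_mul, map_mul, map_mul, hp, eval_X, subst, aeval_X, eval_linearComponent]

theorem subst_subst {l m n : ℕ} (L : (Fin l → ℂ) →ₗ[ℂ] (Fin m → ℂ))
    (M : (Fin m → ℂ) →ₗ[ℂ] (Fin n → ℂ)) (f : MvPolynomial (Fin n) ℂ) :
    subst L (subst M f) = subst (M ∘ₗ L) f :=
  MvPolynomial.funext fun x => by simp [eval_subst]

theorem subst_id {n : ℕ} (f : MvPolynomial (Fin n) ℂ) : subst LinearMap.id f = f :=
  MvPolynomial.funext fun x => by simp [eval_subst]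

theorem isHomogeneous_linearComponent {m n : ℕ} (L : (Fin m → ℂ) →ₗ[ℂ] (Fin n → ℂ)) (i : Fin n) :
    (linearComponent L i).IsHomogeneous 1 :=
  IsHomogeneous.sum _ _ _ fun _ _ => isHomogeneous_C_mul_X _ _

theorem _root_.MvPolynomial.IsHomogeneous.subst {m n d : ℕ} {f : MvPolynomial (Fin n) ℂ}
    (hf : f.IsHomogeneous d) (L : (Fin m → ℂ) →ₗ[ℂ] (Fin n → ℂ)) :
    (subst L f).IsHomogeneous d := by
  have h := hf.aeval _ (isHomogeneous_linearComponent L)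
  rwa [one_mul] at h

theorem subst_symm_subst {n : ℕ} (g : (Fin n → ℂ) ≃ₗ[ℂ] (Fin n → ℂ))
    (f : MvPolynomial (Fin n) ℂ) :
    subst (g.symm : (Fin n → ℂ) →ₗ[ℂ] (Fin n → ℂ))
      (subst (g : (Fin n → ℂ) →ₗ[ℂ] (Fin n → ℂ)) f) = f :=
  MvPolynomial.funext fun x => by simp [eval_subst]

theorem subst_subst_symm {n : ℕ} (g : (Fin n → ℂ) ≃ₗ[ℂ] (Fin n → ℂ))
    (f : MvPolynomial (Fin n) ℂ) :
    subst (g : (Fin n → ℂ) →ₗ[ℂ] (Fin n → ℂ))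
      (subst (g.symm : (Fin n → ℂ) →ₗ[ℂ] (Fin n → ℂ)) f) = f :=
  MvPolynomial.funext fun x => by simp [eval_subst]

theorem pderiv_linearComponent {m n : ℕ} (L : (Fin m → ℂ) →ₗ[ℂ] (Fin n → ℂ)) (i : Fin n)
    (j : Fin m) : pderiv j (linearComponent L i) = C (L (Pi.single j 1) i) := by
  simp only [linearComponent, map_sum, pderiv_C_mul, pderiv_X]
  rw [Finset.sum_eq_single j] <;> simp +contextual

theorem pullback_apply {m n : ℕ} (L : (Fin m → ℂ) →ₗ[ℂ] (Fin n → ℂ)) (ω : OneForm n)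
    (j : Fin m) : pullback L ω j = ∑ i, subst L (ω i) * C (L (Pi.single j 1) i) := by
  simp [pullback, differential, pderiv_linearComponent, subst]

theorem pullback_pullback {l m n : ℕ} (L : (Fin l → ℂ) →ₗ[ℂ] (Fin m → ℂ))
    (M : (Fin m → ℂ) →ₗ[ℂ] (Fin n → ℂ)) (ω : OneForm n) :
    pullback L (pullback M ω) = pullback (M ∘ₗ L) ω := by
  funext k
  simp only [pullback_apply, map_sum, map_mul, subst_subst, Finset.sum_mul]
  rw [Finset.sum_comm]
  refine Finset.sum_congr rfl fun i _ => ?_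
  have h : ∀ a : ℂ, subst L (C a) = C a := fun a => by simp [subst, algebraMap_eq]
  simp only [h, mul_assoc, ← Finset.mul_sum]
  congr 1
  rw [LinearMap.comp_apply, ← eval_linearComponent M]
  simp [linearComponent]

theorem pullback_id {n : ℕ} (ω : OneForm n) : pullback LinearMap.id ω = ω := by
  funext j
  rw [pullback_apply, Finset.sum_eq_single j] <;> simp +contextual [subst_id]

theorem pullback_smul {m n : ℕ} (L : (Fin m → ℂ) →ₗ[ℂ] (Fin n → ℂ))
    (f : MvPolynomial (Fin n) ℂ) (ω : OneForm n) :
    pullback L (f • ω) = subst L f • pullback L ω := by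
  funext j
  simp [pullback_apply, Finset.mul_sum, mul_assoc]

theorem pullback_sub {m n : ℕ} (L : (Fin m → ℂ) →ₗ[ℂ] (Fin n → ℂ)) (ω η : OneForm n) :
    pullback L (ω - η) = pullback L ω - pullback L η := by
  funext j
  simp [pullback_apply, sub_mul]

/-- The chain rule, checked on constants, sums and multiplication by a variable. -/
theorem pullback_differential {m n : ℕ} (L : (Fin m → ℂ) →ₗ[ℂ] (Fin n → ℂ))
    (f : MvPolynomial (Fin n) ℂ) : pullback L (differential f) = differential (subst L f) := by
  funext j
  rw [pullback_apply]
  simp only [differential]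
  induction f using MvPolynomial.induction_on with
  | C a => simp [subst, algebraMap_eq]
  | add p q hp hq => simp [add_mul, Finset.sum_add_distrib, hp, hq]
  | mul_X p i hp =>
    have h : ∑ k, subst L (pderiv k (X i)) * C (L (Pi.single j 1) k) =
        C (L (Pi.single j 1) i) := by
      rw [Finset.sum_eq_single i] <;> simp +contextual [pderiv_X]
    have hX : subst L (X i) = linearComponent L i := by simp [subst]
    simp only [Derivation.leibniz, smul_eq_mul, map_add, map_mul, add_mul,
      Finset.sum_add_distrib, mul_assoc, ← Finset.mul_sum, hp, h, hX, pderiv_linearComponent]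

/-! ### The forms `3 C dQ - 2 Q dC` -/

/-- The form `3 f dg - 2 g df`, which defines the pencil `g ^ 3 / f ^ 2`. -/
def pencilForm {n : ℕ} (f g : MvPolynomial (Fin n) ℂ) : OneForm n :=
  (3 * f) • differential g - (2 * g) • differential f

theorem pullback_pencilForm {m n : ℕ} (L : (Fin m → ℂ) →ₗ[ℂ] (Fin n → ℂ))
    (f g : MvPolynomial (Fin n) ℂ) :
    pullback L (pencilForm f g) = pencilForm (subst L f) (subst L g) := by
  have h2 : subst L 2 = 2 := map_ofNat _ 2
  have h3 : subst L 3 = 3 := map_ofNat _ 3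
  simp [pencilForm, pullback_sub, pullback_smul, pullback_differential, h2, h3]

/-- The commutator of two derivations is a derivation, and this one kills all variables. -/
theorem pderiv_comm' {n : ℕ} (i j : Fin n) (f : MvPolynomial (Fin n) ℂ) :
    pderiv i (pderiv j f) = pderiv j (pderiv i f) := by
  have h : ⁅(pderiv i : Derivation ℂ (MvPolynomial (Fin n) ℂ) _), pderiv j⁆ =
      (0 : Derivation ℂ (MvPolynomial (Fin n) ℂ) _) := by
    ext k
    simp [Derivation.commutator_apply, pderiv_X, Pi.single_apply, apply_ite]
  have := congrArg (fun D => D f) h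
  simpa [Derivation.commutator_apply, sub_eq_zero] using this

/-- The differential of `3f dg - 2g df` is `5 df ∧ dg`, whose wedge with `df` and with `dg` is zero.
-/
theorem isIntegrable_pencilForm {n : ℕ} (f g : MvPolynomial (Fin n) ℂ) :
    IsIntegrable (pencilForm f g) := by
  intro i j k
  have h2 : ∀ i, pderiv i (2 : MvPolynomial (Fin n) ℂ) = 0 := fun i => by
    rw [← map_ofNat C 2, pderiv_C]
  have h3 : ∀ i, pderiv i (3 : MvPolynomial (Fin n) ℂ) = 0 := fun i => by
    rw [← map_ofNat C 3, pderiv_C]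
  simp only [pencilForm, differential, Pi.sub_apply, Pi.smul_apply, smul_eq_mul, map_sub,
    Derivation.leibniz, h2, h3]
  rw [pderiv_comm' j i, pderiv_comm' k i, pderiv_comm' k j, pderiv_comm' j i, pderiv_comm' k i,
    pderiv_comm' k j]
  ring

/-- By Euler's identity the contraction is `3f · 2g - 2g · 3f`; the factors 3 and 2 in the form
match the two degrees. -/
theorem radial_pencilForm {n : ℕ} {f g : MvPolynomial (Fin n) ℂ} (hf : f.IsHomogeneous 3)
    (hg : g.IsHomogeneous 2) : ∑ i, pencilForm f g i * X i = 0 := by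
  have h1 := hf.sum_X_mul_pderiv
  have h2 := hg.sum_X_mul_pderiv
  have : ∑ i, pencilForm f g i * X i =
      3 * f * ∑ i, X i * pderiv i g - 2 * g * ∑ i, X i * pderiv i f := by
    simp only [Finset.mul_sum, ← Finset.sum_sub_distrib]
    refine Finset.sum_congr rfl fun i _ => ?_
    simp [pencilForm, differential]
    ring
  rw [this, h1, h2]
  simp
  ring

/-- If `ω = Fη`, then `ω ∧ dω = F² η ∧ dη`, because the term containing `dF` also contains `η ∧ η`.
-/
theorem IsIntegrable.of_mul {n : ℕ} {ω η : OneForm n} {F : MvPolynomial (Fin n) ℂ} (hF : F ≠ 0)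
    (h : ∀ i, ω i = F * η i) (hω : IsIntegrable ω) : IsIntegrable η := by
  intro i j k
  have := hω i j k
  simp only [h, Derivation.leibniz, smul_eq_mul] at this
  refine (mul_eq_zero.1 (?_ : F ^ 2 * _ = 0)).resolve_left (pow_ne_zero 2 hF)
  linear_combination this

/-! ### Krull dimension of integral extensions -/

/-- Going-up lifts chains of primes from `R` to `S`; incomparability keeps chains strict under
contraction from `S` to `R`. -/
theorem ringKrullDim_eq_of_isIntegral (R S : Type*) [CommRing R] [CommRing S] [Algebra R S]
    [Algebra.IsIntegral R S] [FaithfulSMul R S] : ringKrullDim R = ringKrullDim S := by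
  refine le_antisymm (iSup_le fun l => ?_) ?_
  -- Lying over for the smallest prime of the chain needs only that the contraction of zero is zero,
  -- which is faithfulness.
  · obtain ⟨Q, -, hQ, hQ'⟩ := Ideal.exists_ideal_over_prime_of_isIntegral l.head.asIdeal
      (⊥ : Ideal S) (by simp [← RingHom.ker_eq_comap_bot])
    have : Q.LiesOver l.head.asIdeal := ⟨hQ'.symm⟩
    obtain ⟨L, hL, -⟩ := Ideal.exists_ltSeries_of_hasGoingUp l Q
    rw [← hL]
    exact Order.LTSeries.length_le_krullDim L
  · refine Order.krullDim_le_of_strictMono (PrimeSpectrum.comap (algebraMap R S)) ?_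
    intro I J h
    exact Ideal.IsIntegral.comap_lt_comap (R := R) (I := I.asIdeal) (J := J.asIdeal) h

/-! ### Zero sets in projective space -/

theorem _root_.MvPolynomial.IsHomogeneous.eval_smul_point {n d : ℕ} {f : MvPolynomial (Fin n) ℂ}
    (hf : f.IsHomogeneous d) (c : ℂ) (x : Fin n → ℂ) :
    eval (c • x) f = c ^ d * eval x f := by
  rw [eval_eq', eval_eq', Finset.mul_sum]
  refine Finset.sum_congr rfl fun e he => ?_
  have h : ∏ i, c ^ e i = c ^ d := by
    rw [Finset.prod_pow_eq_pow_sum, hf.degree_eq_sum_deg_support he,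
      ← Finset.sum_subset (Finset.subset_univ e.support) (by simp)]
  simp only [Pi.smul_apply, smul_eq_mul, mul_pow, Finset.prod_mul_distrib, h]
  ring

/-- `projZeros` tests one chosen representative; homogeneity makes the test independent of that
choice. -/
theorem mk_mem_projZeros {n : ℕ} {S : Set (MvPolynomial (Fin n) ℂ)}
    (hS : ∀ f ∈ S, ∃ d, f.IsHomogeneous d) (v : Fin n → ℂ) (hv : v ≠ 0) :
    Projectivization.mk ℂ v hv ∈ projZeros S ↔ ∀ f ∈ S, eval v f = 0 := by
  obtain ⟨a, ha⟩ := Projectivization.exists_smul_eq_mk_rep ℂ v hv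
  refine forall₂_congr fun f hf => ?_
  obtain ⟨d, hd⟩ := hS f hf
  rw [← ha, Units.smul_def, hd.eval_smul_point]
  simp

theorem IsAlgebraic.union {n : ℕ} {A B : Set (ℙ ℂ (Fin n → ℂ))} (hA : IsAlgebraic A)
    (hB : IsAlgebraic B) : IsAlgebraic (A ∪ B) := by
  obtain ⟨S, hS, rfl⟩ := hA
  obtain ⟨T, hT, rfl⟩ := hB
  refine ⟨Set.image2 (· * ·) S T, ?_, ?_⟩
  · rintro _ ⟨f, hf, g, hg, rfl⟩
    obtain ⟨d, hd⟩ := hS f hf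
    obtain ⟨e, he⟩ := hT g hg
    exact ⟨_, hd.mul he⟩
  · ext x
    constructor
    · rintro (h | h) _ ⟨f, hf, g, hg, rfl⟩
      · simp [h f hf]
      · simp [h g hg]
    · intro h
      by_contra hx
      simp only [Set.mem_union, not_or, projZeros, Set.mem_ofPred_eq, not_forall] at hx
      obtain ⟨⟨f, hf, hf'⟩, g, hg, hg'⟩ := hx
      have := h _ ⟨f, hf, g, hg, rfl⟩
      simp [hf', hg'] at this

theorem isAlgebraic_empty {n : ℕ} : IsAlgebraic (∅ : Set (ℙ ℂ (Fin n → ℂ))) :=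
  ⟨{1}, by simpa using ⟨0, isHomogeneous_one _ _⟩, by simp [projZeros]⟩

theorem isAlgebraic_biUnion {n : ℕ} {ι : Type*} (s : Finset ι) (Z : ι → Set (ℙ ℂ (Fin n → ℂ)))
    (hZ : ∀ i, IsAlgebraic (Z i)) : IsAlgebraic (⋃ i ∈ s, Z i) := by
  classical
  induction s using Finset.induction_on with
  | empty => simpa using isAlgebraic_empty
  | insert a s _ ih =>
    rw [Finset.set_biUnion_insert]
    exact (hZ a).union ih

theorem IsIrreducibleAlgebraic.exists_subset {n : ℕ} {ι : Type*} {s : Finset ι}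
    {Z : ι → Set (ℙ ℂ (Fin n → ℂ))} (hZ : ∀ i, IsAlgebraic (Z i)) {Y : Set (ℙ ℂ (Fin n → ℂ))}
    (hY : IsIrreducibleAlgebraic Y) (h : Y ⊆ ⋃ i ∈ s, Z i) : ∃ i ∈ s, Y ⊆ Z i := by
  classical
  induction s using Finset.induction_on with
  | empty =>
    obtain ⟨y, hy⟩ := hY.2.1
    simpa using h hy
  | insert a s _ ih =>
    rw [Finset.set_biUnion_insert] at h
    obtain h | h := hY.2.2 _ _ (hZ a) (isAlgebraic_biUnion s Z hZ) h
    · exact ⟨a, by simp, h⟩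
    · obtain ⟨i, hi, h⟩ := ih h
      exact ⟨i, by simp [hi], h⟩

/-- An irreducible set inside a finite union of closed sets lies in one of them, so the members are
the maximal irreducible subsets. The hypothesis `hZ'` says that the members are distinct and that
none contains another. -/
theorem isIrredComponent_iUnion_iff {n : ℕ} {ι : Type*} [Fintype ι]
    {Z : ι → Set (ℙ ℂ (Fin n → ℂ))} (hZ : ∀ i, IsIrreducibleAlgebraic (Z i))
    (hZ' : ∀ i j, Z i ⊆ Z j → i = j) (Y : Set (ℙ ℂ (Fin n → ℂ))) :
    IsIrredComponent Y (⋃ i, Z i) ↔ ∃ i, Y = Z i := by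
  have key : ∀ Y, IsIrreducibleAlgebraic Y → Y ⊆ ⋃ i, Z i → ∃ i, Y ⊆ Z i := fun Y hY h => by
    obtain ⟨i, -, hi⟩ := hY.exists_subset (s := Finset.univ) (fun i => (hZ i).1) (by simpa using h)
    exact ⟨i, hi⟩
  constructor
  · rintro ⟨hY, hYS, hmax⟩
    obtain ⟨i, hi⟩ := key Y hY hYS
    exact ⟨i, (hmax _ (hZ i) hi (Set.subset_iUnion Z i)).symm⟩
  · rintro ⟨i, rfl⟩
    refine ⟨hZ i, Set.subset_iUnion Z i, fun Y hY hiY hYS => ?_⟩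
    obtain ⟨j, hj⟩ := key Y hY hYS
    obtain rfl := hZ' i j (hiY.trans hj)
    exact hj.antisymm hiY

theorem sUnion_isIrredComponent_iUnion {n : ℕ} {ι : Type*} [Fintype ι]
    {Z : ι → Set (ℙ ℂ (Fin n → ℂ))} {d : ι → ℕ} (hZ : ∀ i, IsIrreducibleAlgebraic (Z i))
    (hZ' : ∀ i j, Z i ⊆ Z j → i = j) (hd : ∀ i, HasDim (Z i) (d i)) (k : ℕ) :
    ⋃₀ {Y | IsIrredComponent Y (⋃ i, Z i) ∧ HasDim Y k} = ⋃ i, ⋃ (_ : d i = k), Z i := by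
  have hdim : ∀ i, HasDim (Z i) k ↔ d i = k := fun i => by
    have h := hd i
    constructor
    · intro h'
      have h'' := h.symm.trans h'
      norm_cast at h''
      omega
    · rintro rfl
      exact h
  ext x
  simp only [isIrredComponent_iUnion_iff hZ hZ', Set.mem_sUnion, Set.mem_ofPred_eq, Set.mem_iUnion]
  constructor
  · rintro ⟨_, ⟨⟨i, rfl⟩, h⟩, hx⟩
    exact ⟨i, (hdim i).1 h, hx⟩
  · rintro ⟨i, h, hx⟩
    exact ⟨_, ⟨⟨i, rfl⟩, (hdim i).2 h⟩, hx⟩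

/-! ### Linear changes of coordinates -/

/-- The projective transformation defined by a linear equivalence. -/
def projMap {n : ℕ} (g : (Fin n → ℂ) ≃ₗ[ℂ] (Fin n → ℂ)) :
    ℙ ℂ (Fin n → ℂ) → ℙ ℂ (Fin n → ℂ) :=
  Projectivization.map (g : (Fin n → ℂ) →ₗ[ℂ] (Fin n → ℂ)) g.injective

theorem projMap_mk {n : ℕ} (g : (Fin n → ℂ) ≃ₗ[ℂ] (Fin n → ℂ)) (v : Fin n → ℂ) (hv : v ≠ 0) :
    projMap g (Projectivization.mk ℂ v hv) =
      Projectivization.mk ℂ (g v) (by simpa using hv) := rfl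

theorem projMap_projMap_symm {n : ℕ} (g : (Fin n → ℂ) ≃ₗ[ℂ] (Fin n → ℂ)) (x : ℙ ℂ (Fin n → ℂ)) :
    projMap g (projMap g.symm x) = x := by
  induction x using Projectivization.ind with
  | h v hv => simp [projMap_mk]

theorem projMap_symm_projMap {n : ℕ} (g : (Fin n → ℂ) ≃ₗ[ℂ] (Fin n → ℂ)) (x : ℙ ℂ (Fin n → ℂ)) :
    projMap g.symm (projMap g x) = x :=
  projMap_projMap_symm g.symm x

theorem preimage_projZeros {n : ℕ} {S : Set (MvPolynomial (Fin n) ℂ)}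
    (hS : ∀ f ∈ S, ∃ d, f.IsHomogeneous d) (g : (Fin n → ℂ) ≃ₗ[ℂ] (Fin n → ℂ)) :
    projMap g ⁻¹' projZeros S =
      projZeros (subst (g : (Fin n → ℂ) →ₗ[ℂ] (Fin n → ℂ)) '' S) := by
  ext x
  induction x using Projectivization.ind with
  | h v hv =>
    have hS' : ∀ f ∈ subst (g : (Fin n → ℂ) →ₗ[ℂ] (Fin n → ℂ)) '' S, ∃ d, f.IsHomogeneous d := by
      rintro _ ⟨f, hf, rfl⟩
      obtain ⟨d, hd⟩ := hS f hf
      exact ⟨d, hd.subst _⟩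
    rw [Set.mem_preimage, projMap_mk, mk_mem_projZeros hS, mk_mem_projZeros hS']
    simp [eval_subst]

theorem IsAlgebraic.preimage {n : ℕ} {Z : Set (ℙ ℂ (Fin n → ℂ))} (hZ : IsAlgebraic Z)
    (g : (Fin n → ℂ) ≃ₗ[ℂ] (Fin n → ℂ)) : IsAlgebraic (projMap g ⁻¹' Z) := by
  obtain ⟨S, hS, rfl⟩ := hZ
  refine ⟨_, ?_, preimage_projZeros hS g⟩
  rintro _ ⟨f, hf, rfl⟩
  obtain ⟨d, hd⟩ := hS f hf
  exact ⟨d, hd.subst _⟩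

theorem IsIrreducibleAlgebraic.preimage {n : ℕ} {Z : Set (ℙ ℂ (Fin n → ℂ))}
    (hZ : IsIrreducibleAlgebraic Z) (g : (Fin n → ℂ) ≃ₗ[ℂ] (Fin n → ℂ)) :
    IsIrreducibleAlgebraic (projMap g ⁻¹' Z) := by
  have hsub : ∀ A : Set (ℙ ℂ (Fin n → ℂ)), Z ⊆ projMap g.symm ⁻¹' A → projMap g ⁻¹' Z ⊆ A :=
    fun A h x hx => by simpa [projMap_symm_projMap] using h hx
  refine ⟨hZ.1.preimage g, ?_, fun A B hA hB h => ?_⟩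
  · obtain ⟨z, hz⟩ := hZ.2.1
    exact ⟨projMap g.symm z, by simpa [projMap_projMap_symm] using hz⟩
  · refine (hZ.2.2 _ _ (hA.preimage g.symm) (hB.preimage g.symm) fun z hz => ?_).imp
      (hsub A) (hsub B)
    exact h (show projMap g (projMap g.symm z) ∈ Z by rwa [projMap_projMap_symm])

/-- Substitution by `g` is an automorphism of the polynomial ring which carries one vanishing ideal
to the other, so the coordinate rings are isomorphic. -/
theorem HasDim.preimage {n k : ℕ} {Z : Set (ℙ ℂ (Fin n → ℂ))} (hZ : HasDim Z k)
    (g : (Fin n → ℂ) ≃ₗ[ℂ] (Fin n → ℂ)) : HasDim (projMap g ⁻¹' Z) k := by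
  let e : MvPolynomial (Fin n) ℂ ≃ₐ[ℂ] MvPolynomial (Fin n) ℂ :=
    AlgEquiv.ofAlgHom (subst (g : (Fin n → ℂ) →ₗ[ℂ] (Fin n → ℂ)))
      (subst (g.symm : (Fin n → ℂ) →ₗ[ℂ] (Fin n → ℂ)))
      (AlgHom.ext fun f => subst_subst_symm g f) (AlgHom.ext fun f => subst_symm_subst g f)
  have h : vanishingIdeal ℂ (cone (projMap g ⁻¹' Z)) =
      (vanishingIdeal ℂ (cone Z)).map (e : _ →+* MvPolynomial (Fin n) ℂ) := by
    have h' : (vanishingIdeal ℂ (cone Z)).map (e : _ →+* MvPolynomial (Fin n) ℂ) =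
        (vanishingIdeal ℂ (cone Z)).comap (e.symm : _ →+* MvPolynomial (Fin n) ℂ) :=
      Ideal.map_comap_of_equiv e.toRingEquiv
    rw [h']
    ext f
    simp only [mem_vanishingIdeal_iff, Ideal.mem_comap, aeval_eq_eval]
    constructor
    · rintro hf v ⟨hv, hvZ⟩
      have h1 := hf (g.symm v) ⟨by simpa using hv, by simpa [projMap_mk] using hvZ⟩
      exact (eval_subst _ f v).trans h1
    · rintro hf v ⟨hv, hvZ⟩
      have h1 : eval (g v) (subst (g.symm : (Fin n → ℂ) →ₗ[ℂ] (Fin n → ℂ)) f) = 0 :=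
        hf (g v) ⟨by simpa using hv, by simpa [projMap_mk] using hvZ⟩
      simpa [eval_subst] using h1
  rw [HasDim, ← hZ]
  exact (ringKrullDim_eq_of_ringEquiv (Ideal.quotientEquivAlg _ _ e h).toRingEquiv).symm

/-! ### Parametrized subsets of projective space -/

/-- The points of `ℙ^{n-1}` of the form `[f(s)]`, where `f` is a family of polynomials. -/
def paramSet {m n : ℕ} (f : Fin n → MvPolynomial (Fin m) ℂ) : Set (ℙ ℂ (Fin n → ℂ)) :=
  {x | ∃ (s : Fin m → ℂ) (c : ℂ), x.rep = c • fun i => eval s (f i)}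

theorem mk_mem_paramSet {m n : ℕ} {f : Fin n → MvPolynomial (Fin m) ℂ} (v : Fin n → ℂ)
    (hv : v ≠ 0) : Projectivization.mk ℂ v hv ∈ paramSet f ↔
      ∃ (s : Fin m → ℂ) (c : ℂ), v = c • fun i => eval s (f i) := by
  obtain ⟨a, ha⟩ := Projectivization.exists_smul_eq_mk_rep ℂ v hv
  simp only [paramSet, Set.mem_ofPred_eq, ← ha]
  refine exists_congr fun s => ⟨?_, ?_⟩
  · rintro ⟨c, hc⟩
    exact ⟨(a⁻¹ : ℂˣ) * c, by rw [mul_smul, ← hc, ← Units.smul_def, inv_smul_smul]⟩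
  · rintro ⟨c, hc⟩
    exact ⟨a * c, by rw [mul_smul, ← hc, Units.smul_def]⟩

/-- A polynomial vanishes on all points `f(s)` exactly when its composition with `f` is the zero
polynomial, `ℂ` being infinite. -/
theorem vanishingIdeal_cone_paramSet {m n d : ℕ} (hd : 0 < d)
    {f : Fin n → MvPolynomial (Fin m) ℂ} (hf : ∀ i, (f i).IsHomogeneous d) (hf0 : f ≠ 0) :
    vanishingIdeal ℂ (cone (paramSet f)) = RingHom.ker (aeval f) := by
  have hev : ∀ (s : Fin m → ℂ) (p : MvPolynomial (Fin n) ℂ),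
      eval s (aeval f p) = eval (fun i => eval s (f i)) p := fun s p => by
    induction p using MvPolynomial.induction_on with
    | C a => rw [aeval_C, algebraMap_eq, eval_C, eval_C]
    | add p q hp hq => rw [map_add, map_add, map_add, hp, hq]
    | mul_X p i hp => rw [map_mul, map_mul, map_mul, hp, eval_X, aeval_X]
  ext p
  simp only [mem_vanishingIdeal_iff, RingHom.mem_ker, aeval_eq_eval]
  constructor
  · intro h
    obtain ⟨i, hi⟩ := Function.ne_iff.1 hf0
    -- Where all coordinates vanish, `f(s)` is not a projective point and gives no information; the
    -- factor `f i ≠ 0` removes these parameters.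
    refine (mul_eq_zero.1 (?_ : aeval f p * f i = 0)).resolve_right hi
    refine MvPolynomial.funext fun s => ?_
    rw [map_mul, hev, map_zero]
    by_cases hs : eval s (f i) = 0
    · rw [hs, mul_zero]
    · have hv : (fun i => eval s (f i)) ≠ 0 := fun h0 => hs (congrFun h0 i)
      have h1 : eval (fun i => eval s (f i)) p = 0 :=
        h _ ⟨hv, (mk_mem_paramSet _ _).2 ⟨s, 1, by simp⟩⟩
      rw [h1, zero_mul]
  · rintro h v ⟨hv, hvZ⟩
    obtain ⟨s, c, rfl⟩ := (mk_mem_paramSet _ _).1 hvZ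
    -- A `d`-th root of the scalar can be absorbed into the parameter, since all coordinates have
    -- the same degree `d`.
    obtain ⟨b, hb⟩ := IsAlgClosed.exists_pow_nat_eq c hd
    have : (c • fun i => eval s (f i)) = fun i => eval (b • s) (f i) := by
      funext i
      rw [(hf i).eval_smul_point, hb]
      rfl
    have h1 : eval (c • fun i => eval s (f i)) p = 0 := by
      rw [this, ← hev, h, map_zero]
    exact h1

theorem isIrreducibleAlgebraic_of_isPrime {n : ℕ} {Z : Set (ℙ ℂ (Fin n → ℂ))}
    (hZ : IsAlgebraic Z) (hI : (vanishingIdeal ℂ (cone Z)).IsPrime) :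
    IsIrreducibleAlgebraic Z := by
  refine ⟨hZ, ?_, ?_⟩
  · by_contra h
    rw [Set.not_nonempty_iff_eq_empty] at h
    refine hI.ne_top ((Ideal.eq_top_iff_one _).2 ?_)
    rintro v ⟨hv, hvZ⟩
    simp [h] at hvZ
  · rintro A B ⟨S, hS, rfl⟩ ⟨T, hT, rfl⟩ h
    have key : ∀ U : Set (MvPolynomial (Fin n) ℂ), ¬ Z ⊆ projZeros U →
        ∃ f ∈ U, f ∉ vanishingIdeal ℂ (cone Z) := fun U hU => by
      obtain ⟨x, hx, hxU⟩ := Set.not_subset.1 hU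
      simp only [projZeros, Set.mem_ofPred_eq, not_forall] at hxU
      obtain ⟨f, hf, hfx⟩ := hxU
      exact ⟨f, hf, fun hI => hfx (hI x.rep ⟨x.rep_nonzero, by rwa [x.mk_rep]⟩)⟩
    by_contra! hc
    obtain ⟨f, hf, hfI⟩ := key S hc.1
    obtain ⟨g, hg, hgI⟩ := key T hc.2
    refine (hI.mul_mem_iff_mem_or_mem.1 (?_ : f * g ∈ _)).elim hfI hgI
    rintro v ⟨hv, hvZ⟩
    rw [map_mul, mul_eq_zero]
    exact (h hvZ).imp (fun h' => (mk_mem_projZeros hS v hv).1 h' f hf)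
      (fun h' => (mk_mem_projZeros hT v hv).1 h' g hg)

theorem isIrreducibleAlgebraic_paramSet {m n d : ℕ} (hd : 0 < d)
    {f : Fin n → MvPolynomial (Fin m) ℂ} (hf : ∀ i, (f i).IsHomogeneous d) (hf0 : f ≠ 0)
    (hZ : IsAlgebraic (paramSet f)) : IsIrreducibleAlgebraic (paramSet f) := by
  refine isIrreducibleAlgebraic_of_isPrime hZ ?_
  rw [vanishingIdeal_cone_paramSet hd hf hf0]
  exact RingHom.ker_isPrime _

/-- The coordinate ring is the subring generated by the `f i`. By `hX` it contains a positive power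
of every variable, so the polynomial ring in `m + 1` variables is integral over it and the Krull
dimension is `m + 1`. -/
theorem hasDim_paramSet {m n d : ℕ} (hd : 0 < d)
    {f : Fin n → MvPolynomial (Fin (m + 1)) ℂ} (hf : ∀ i, (f i).IsHomogeneous d)
    (hX : ∀ j, ∃ p : MvPolynomial (Fin n) ℂ, aeval f p = X j ^ d) :
    HasDim (paramSet f) m := by
  have hf0 : f ≠ 0 := by
    rintro rfl
    obtain ⟨p, hp⟩ := hX 0
    have h1 := congrArg (eval 0) hp
    have h2 := congrArg (eval (fun _ => 1)) hp
    rw [aeval_zero, algebraMap_eq, eval_C] at h1 h2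
    simp [hd.ne'] at h1 h2
    simp [h1] at h2
  have hint : Algebra.IsIntegral (aeval (R := ℂ) f).range (MvPolynomial (Fin (m + 1)) ℂ) := by
    constructor
    intro q
    induction q using MvPolynomial.induction_on with
    | C a =>
      exact isIntegral_algebraMap (x := algebraMap ℂ (aeval (R := ℂ) f).range a)
    | add p q hp hq => exact hp.add hq
    | mul_X p j hp =>
      refine hp.mul (IsIntegral.of_pow hd ?_)
      exact isIntegral_algebraMap (x := (⟨X j ^ d, hX j⟩ : (aeval (R := ℂ) f).range))
  rw [HasDim, vanishingIdeal_cone_paramSet hd hf hf0,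
    ringKrullDim_eq_of_ringEquiv (Ideal.quotientKerEquivRange (aeval (R := ℂ) f)).toRingEquiv,
    ringKrullDim_eq_of_isIntegral (aeval (R := ℂ) f).range (MvPolynomial (Fin (m + 1)) ℂ),
    MvPolynomial.ringKrullDim_of_isNoetherianRing, ringKrullDim_eq_zero_of_field]
  simp

/-! ### Common divisors of the coefficients of the exceptional form -/

theorem not_dvd_of_eval {n : ℕ} {f g : MvPolynomial (Fin n) ℂ} (x : Fin n → ℂ)
    (hf : eval x f = 0) (hg : eval x g ≠ 0) : ¬ f ∣ g := by
  rintro ⟨h, rfl⟩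
  simp [hf] at hg

theorem degreeOf_eq_zero_of_dvd {n : ℕ} {f g : MvPolynomial (Fin n) ℂ} (h : f ∣ g) (hg : g ≠ 0)
    {i : Fin n} (hi : g.degreeOf i = 0) : f.degreeOf i = 0 := by
  obtain ⟨k, rfl⟩ := h
  rw [degreeOf_mul_eq (left_ne_zero_of_mul hg) (right_ne_zero_of_mul hg)] at hi
  omega

/-- The substitution which replaces the variables outside `s` by zero. -/
def restrictVars {n : ℕ} (s : Finset (Fin n)) :
    MvPolynomial (Fin n) ℂ →ₐ[ℂ] MvPolynomial (Fin n) ℂ :=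
  aeval fun i => if i ∈ s then X i else 0

theorem restrictVars_eq_self {n : ℕ} {s : Finset (Fin n)} {f : MvPolynomial (Fin n) ℂ}
    (h : ∀ i ∉ s, f.degreeOf i = 0) : restrictVars s f = f := by
  refine hom_congr_vars (f₁ := (restrictVars s : _ →+* MvPolynomial (Fin n) ℂ))
    (f₂ := RingHom.id _) ?_ ?_ rfl
  · ext1 a
    simp [restrictVars, algebraMap_eq]
  · intro i hi _
    have : i ∈ s := by
      by_contra his
      exact mem_vars_iff_degreeOf_ne_zero.1 hi (h i his)
    simp [restrictVars, this]

/-- A prime common factor `P` is not `X 3`, as the last coefficient does not vanish on that plane.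
So `P` divides both `2x₁² - 3x₀x₂`, free of `x₃`, and `x₀² - 2x₁x₃`, free of `x₂`. Hence it involves
only `x₀` and `x₁`, and setting the other variables to zero shows that it divides `x₀²` and `2x₁²`,
which is impossible. -/
theorem isUnit_of_dvd_exceptionalForm {D : MvPolynomial (Fin 4) ℂ}
    (hD : ∀ i, D ∣ exceptionalForm i) : IsUnit D := by
  have hD0 : D ≠ 0 := by
    rintro rfl
    have h := congrArg (eval ![1, 0, 0, 1]) (zero_dvd_iff.1 (hD 2))
    simp [exceptionalForm] at h
  by_contra hu
  obtain ⟨P, hP, hPD⟩ := WfDvdMonoid.exists_irreducible_factor hu hD0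
  have hP' : Prime P := hP.prime
  have h0 : P ∣ X 3 * (2 * X 1 ^ 2 - 3 * X 0 * X 2) := hPD.trans (hD 0)
  have h2 : P ∣ X 3 * (X 0 ^ 2 - 2 * X 1 * X 3) := hPD.trans (hD 2)
  have h3 : P ∣ -(X 0 * X 1 ^ 2 - 2 * X 0 ^ 2 * X 2 + X 1 * X 2 * X 3) := hPD.trans (hD 3)
  have hn : ¬ P ∣ X 3 := by
    intro h
    refine not_dvd_of_eval ![1, 1, 0, 0] ?_ ?_
      (((hP'.associated_of_dvd X_prime h).symm.dvd).trans h3) <;> simp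
  replace h0 := (hP'.dvd_or_dvd h0).resolve_left hn
  replace h2 := (hP'.dvd_or_dvd h2).resolve_left hn
  have hs0 : (2 * X 1 ^ 2 - 3 * X 0 * X 2 : MvPolynomial (Fin 4) ℂ) ≠ 0 := fun h => by
    simpa using congrArg (eval ![0, 1, 0, 0]) h
  have hq0 : (X 0 ^ 2 - 2 * X 1 * X 3 : MvPolynomial (Fin 4) ℂ) ≠ 0 := fun h => by
    simpa using congrArg (eval ![1, 0, 0, 0]) h
  have hq : (X 0 ^ 2 - 2 * X 1 * X 3 : MvPolynomial (Fin 4) ℂ).degreeOf 2 = 0 := by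
    have e1 := degreeOf_sub_le (2 : Fin 4) (X 0 ^ 2 : MvPolynomial (Fin 4) ℂ) (C 2 * (X 1 * X 3))
    have e2 := degreeOf_pow_le (2 : Fin 4) (X 0 : MvPolynomial (Fin 4) ℂ) 2
    have e3 := degreeOf_C_mul_le (X 1 * X 3 : MvPolynomial (Fin 4) ℂ) 2 2
    have e4 := degreeOf_mul_le (2 : Fin 4) (X 1 : MvPolynomial (Fin 4) ℂ) (X 3)
    simp only [degreeOf_X] at e2 e4
    rw [map_ofNat, ← mul_assoc] at e1
    rw [map_ofNat, ← mul_assoc] at e3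
    simp at e2 e4
    simp only [e4, Nat.le_zero] at e3
    simpa [e2, e3] using e1
  have hs : (2 * X 1 ^ 2 - 3 * X 0 * X 2 : MvPolynomial (Fin 4) ℂ).degreeOf 3 = 0 := by
    have e1 := degreeOf_sub_le (3 : Fin 4) (C 2 * X 1 ^ 2 : MvPolynomial (Fin 4) ℂ)
      (C 3 * (X 0 * X 2))
    have e2 := degreeOf_pow_le (3 : Fin 4) (X 1 : MvPolynomial (Fin 4) ℂ) 2
    have e3 := degreeOf_C_mul_le (X 0 * X 2 : MvPolynomial (Fin 4) ℂ) 3 3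
    have e4 := degreeOf_mul_le (3 : Fin 4) (X 0 : MvPolynomial (Fin 4) ℂ) (X 2)
    have e5 := degreeOf_C_mul_le (X 1 ^ 2 : MvPolynomial (Fin 4) ℂ) 3 2
    simp only [degreeOf_X] at e2 e4
    rw [map_ofNat, map_ofNat, ← mul_assoc] at e1
    rw [map_ofNat, ← mul_assoc] at e3
    rw [map_ofNat] at e5
    simp at e2 e4
    simp only [e2, e4, Nat.le_zero] at e3 e5
    simpa [e3, e5] using e1
  have hfree : restrictVars {0, 1} P = P := by
    refine restrictVars_eq_self fun i hi => ?_
    fin_cases i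
    · simp at hi
    · simp at hi
    · exact degreeOf_eq_zero_of_dvd h2 hq0 hq
    · exact degreeOf_eq_zero_of_dvd h0 hs0 hs
  have k0 := map_dvd (restrictVars {0, 1}) h2
  have k1 := map_dvd (restrictVars {0, 1}) h0
  rw [hfree] at k0 k1
  have t2 : restrictVars {0, 1} (2 : MvPolynomial (Fin 4) ℂ) = 2 := map_ofNat _ 2
  simp [restrictVars] at k0 k1 t2
  have hP0 : P ∣ X 0 := hP'.dvd_of_dvd_pow k0
  rw [t2, ← map_ofNat C 2] at k1
  have hP1 : P ∣ X 1 := by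
    refine hP'.dvd_of_dvd_pow (n := 2) ?_
    have := k1.mul_left (C (1 / 2))
    rwa [← mul_assoc, ← C_mul, one_div, inv_mul_cancel₀ two_ne_zero, C_1, one_mul] at this
  refine not_dvd_of_eval ![0, 1, 0, 0] ?_ ?_
    (((hP'.associated_of_dvd X_prime hP0).symm.dvd).trans hP1) <;> simp

/-- After the common part `d` of `G` and `a` is removed, the rest of `G` is coprime to the rest of
`a`, so it divides every `ω i` and is a unit. -/
theorem dvd_of_dvd_mul_of_isUnit {n : ℕ} {a G : MvPolynomial (Fin n) ℂ} (ha : a ≠ 0)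
    {ω : OneForm n} (hω : ∀ D, (∀ i, D ∣ ω i) → IsUnit D) (hG : ∀ i, G ∣ a * ω i) : G ∣ a := by
  obtain ⟨G', a', d, hrel, rfl, rfl⟩ := UniqueFactorizationMonoid.exists_reduced_factors' G a ha
  have hd : d ≠ 0 := left_ne_zero_of_mul ha
  have : IsUnit G' := hω G' fun i => by
    have h := hG i
    rw [mul_assoc] at h
    exact hrel.dvd_of_dvd_mul_left ((mul_dvd_mul_iff_left hd).1 h)
  exact mul_dvd_mul_left d (this.dvd)

/-! ### The restriction of the form and its reductions -/

/-- The linear form which vanishes on the osculating plane, in coordinates changed by `g`. -/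
def planeForm (g : (Fin 4 → ℂ) ≃ₗ[ℂ] (Fin 4 → ℂ)) : MvPolynomial (Fin 4) ℂ :=
  subst (g : (Fin 4 → ℂ) →ₗ[ℂ] (Fin 4 → ℂ)) (18 * X 3)

theorem isHomogeneous_planeForm (g : (Fin 4 → ℂ) ≃ₗ[ℂ] (Fin 4 → ℂ)) :
    (planeForm g).IsHomogeneous 1 := by
  refine IsHomogeneous.subst ?_ _
  rw [← map_ofNat C 18]
  exact isHomogeneous_C_mul_X _ _

theorem planeForm_ne_zero (g : (Fin 4 → ℂ) ≃ₗ[ℂ] (Fin 4 → ℂ)) : planeForm g ≠ 0 := by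
  intro h
  have := congrArg (eval (g.symm ![0, 0, 0, 1])) h
  simp [planeForm, eval_subst] at this

/-- Pulling back along `g.symm` turns the claim into one about `18 * X 3` and the standard form,
whose coefficients have no common factor. -/
theorem dvd_planeForm {g : (Fin 4 → ℂ) ≃ₗ[ℂ] (Fin 4 → ℂ)} {G : MvPolynomial (Fin 4) ℂ}
    (hG : ∀ i, G ∣ planeForm g * pullback (g : (Fin 4 → ℂ) →ₗ[ℂ] (Fin 4 → ℂ)) exceptionalForm i) :
    G ∣ planeForm g := by
  have h : subst (g.symm : (Fin 4 → ℂ) →ₗ[ℂ] (Fin 4 → ℂ)) G ∣ 18 * X 3 := by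
    refine dvd_of_dvd_mul_of_isUnit (ω := exceptionalForm) ?_
      (fun D => isUnit_of_dvd_exceptionalForm) fun j => ?_
    · intro h
      simpa using congrArg (eval ![0, 0, 0, 1]) h
    · have key : pullback (g.symm : (Fin 4 → ℂ) →ₗ[ℂ] (Fin 4 → ℂ)) (planeForm g •
          pullback (g : (Fin 4 → ℂ) →ₗ[ℂ] (Fin 4 → ℂ)) exceptionalForm) =
          (18 * X 3 : MvPolynomial (Fin 4) ℂ) • exceptionalForm := by
        rw [planeForm, ← pullback_smul, pullback_pullback, LinearEquiv.comp_coe,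
          LinearEquiv.symm_trans_self, LinearEquiv.refl_toLinearMap, pullback_id]
      have := congrFun key j
      rw [Pi.smul_apply, smul_eq_mul] at this
      rw [← this, pullback_apply]
      refine Finset.dvd_sum fun i _ => Dvd.dvd.mul_right (map_dvd _ ?_) _
      exact hG i
  have := map_dvd (subst (g : (Fin 4 → ℂ) →ₗ[ℂ] (Fin 4 → ℂ))) h
  rwa [subst_subst_symm] at this

theorem isReduction_planeForm (g : (Fin 4 → ℂ) ≃ₗ[ℂ] (Fin 4 → ℂ)) :
    IsReduction (planeForm g • pullback (g : (Fin 4 → ℂ) →ₗ[ℂ] (Fin 4 → ℂ)) exceptionalForm)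
      (planeForm g) (pullback (g : (Fin 4 → ℂ) →ₗ[ℂ] (Fin 4 → ℂ)) exceptionalForm) := by
  refine ⟨1, isHomogeneous_planeForm g, planeForm_ne_zero g, fun i => rfl,
    fun G e hG hG0 hdvd => ?_⟩
  have := totalDegree_le_of_dvd_of_isDomain (dvd_planeForm hdvd) (planeForm_ne_zero g)
  rwa [hG.totalDegree hG0, (isHomogeneous_planeForm g).totalDegree (planeForm_ne_zero g)] at this

/-- `F` divides the linear form `planeForm g`, and maximality makes its degree at least one; so the
cofactor is constant. -/
theorem IsReduction.eq_planeForm {g : (Fin 4 → ℂ) ≃ₗ[ℂ] (Fin 4 → ℂ)}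
    {F : MvPolynomial (Fin 4) ℂ} {η : OneForm 4}
    (h : IsReduction (planeForm g •
      pullback (g : (Fin 4 → ℂ) →ₗ[ℂ] (Fin 4 → ℂ)) exceptionalForm) F η) :
    F.IsHomogeneous 1 ∧ ∃ c : ℂ, c ≠ 0 ∧ planeForm g = F * C c ∧
      η = c • pullback (g : (Fin 4 → ℂ) →ₗ[ℂ] (Fin 4 → ℂ)) exceptionalForm := by
  obtain ⟨e, hF, hF0, hη, hmax⟩ := h
  have h0 := planeForm_ne_zero g
  have h1 := isHomogeneous_planeForm g
  obtain ⟨u, hu⟩ : F ∣ planeForm g := dvd_planeForm fun i => ⟨η i, hη i⟩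
  have hu0 : u ≠ 0 := by
    rintro rfl
    exact h0 (by simpa using hu)
  have he : 1 ≤ e := hmax (planeForm g) 1 h1 h0 fun i => ⟨_, rfl⟩
  have hdeg : 1 = e + u.totalDegree := by
    rw [← h1.totalDegree h0, ← hF.totalDegree hF0, ← totalDegree_mul_of_isDomain hF0 hu0, ← hu]
  obtain rfl : e = 1 := by omega
  have hu1 : u = C (coeff 0 u) := totalDegree_eq_zero_iff_eq_C.1 (by omega)
  rw [hu1] at hu hu0
  refine ⟨hF, coeff 0 u, by simpa using hu0, hu, ?_⟩
  funext i
  refine mul_left_cancel₀ hF0 ?_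
  rw [← hη i, hu, Pi.smul_apply, Pi.smul_apply, smul_eq_mul, smul_eq_C_mul, mul_assoc]

/-! ### The zeros of the exceptional form -/

/-- Equations of the line, the conic and the twisted cubic of zeros of the exceptional form. -/
def curveEqs : Fin 3 → Set (MvPolynomial (Fin 4) ℂ) :=
  ![{X 0, X 3}, {X 3, X 1 ^ 2 - 2 * (X 0 * X 2)},
    {X 0 ^ 2 - 2 * (X 1 * X 3), 3 * (X 2 * X 3) - X 0 * X 1, 2 * X 1 ^ 2 - 3 * (X 0 * X 2)}]

/-- Parametrizations of the line, the conic and the twisted cubic. -/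
def curveParam : Fin 3 → Fin 4 → MvPolynomial (Fin 2) ℂ :=
  ![![0, X 1, 2 * X 0, 0], ![X 1 ^ 2, 2 * (X 0 * X 1), 2 * X 0 ^ 2, 0],
    ![6 * (X 0 * X 1 ^ 2), 6 * (X 0 ^ 2 * X 1), 4 * X 0 ^ 3, 3 * X 1 ^ 3]]

/-- A parametrization of the plane `x₃ = 0`. -/
def planeParam : Fin 4 → MvPolynomial (Fin 3) ℂ := ![X 0, X 1, X 2, 0]

theorem _root_.MvPolynomial.IsHomogeneous.ofNat_mul {n d k : ℕ} [k.AtLeastTwo]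
    {f : MvPolynomial (Fin n) ℂ} (hf : f.IsHomogeneous d) :
    ((OfNat.ofNat k : MvPolynomial (Fin n) ℂ) * f).IsHomogeneous d := by
  rw [← map_ofNat C k]
  exact hf.C_mul _

theorem isHomogeneous_X_mul {n d : ℕ} {f : MvPolynomial (Fin n) ℂ} (hf : f.IsHomogeneous d)
    (i : Fin n) : (X i * f).IsHomogeneous (d + 1) := by
  rw [add_comm]
  exact (isHomogeneous_X _ _).mul hf

theorem isHomogeneous_X_sq {n : ℕ} (i : Fin n) :
    (X i ^ 2 : MvPolynomial (Fin n) ℂ).IsHomogeneous 2 :=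
  isHomogeneous_X_pow _ _

theorem isHomogeneous_X_mul_X {n : ℕ} (i j : Fin n) :
    (X i * X j : MvPolynomial (Fin n) ℂ).IsHomogeneous 2 :=
  isHomogeneous_X_mul (isHomogeneous_X _ _) _

theorem isHomogeneous_curveEqs (i : Fin 3) : ∀ f ∈ curveEqs i, ∃ d, f.IsHomogeneous d := by
  fin_cases i
  · rintro f (rfl | rfl) <;> exact ⟨1, isHomogeneous_X _ _⟩
  · rintro f (rfl | rfl)
    · exact ⟨1, isHomogeneous_X _ _⟩
    · exact ⟨2, (isHomogeneous_X_sq _).sub (isHomogeneous_X_mul_X _ _).ofNat_mul⟩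
  · rintro f (rfl | rfl | rfl)
    · exact ⟨2, (isHomogeneous_X_sq _).sub (isHomogeneous_X_mul_X _ _).ofNat_mul⟩
    · exact ⟨2, (isHomogeneous_X_mul_X _ _).ofNat_mul.sub (isHomogeneous_X_mul_X _ _)⟩
    · exact ⟨2, (isHomogeneous_X_sq _).ofNat_mul.sub (isHomogeneous_X_mul_X _ _).ofNat_mul⟩

theorem isHomogeneous_curveParam (i : Fin 3) (j : Fin 4) :
    (curveParam i j).IsHomogeneous (i + 1) := by
  fin_cases i <;> fin_cases j
  · exact isHomogeneous_zero _ _ _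
  · exact isHomogeneous_X _ _
  · exact (isHomogeneous_X _ _).ofNat_mul
  · exact isHomogeneous_zero _ _ _
  · exact isHomogeneous_X_sq _
  · exact (isHomogeneous_X_mul_X _ _).ofNat_mul
  · exact (isHomogeneous_X_sq _).ofNat_mul
  · exact isHomogeneous_zero _ _ _
  · exact (isHomogeneous_X_mul (isHomogeneous_X_sq _) _).ofNat_mul
  · exact ((isHomogeneous_X_sq _).mul (isHomogeneous_X _ _)).ofNat_mul
  · exact (isHomogeneous_X_pow _ _).ofNat_mul
  · exact (isHomogeneous_X_pow _ _).ofNat_mul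

theorem isHomogeneous_planeParam (j : Fin 4) : (planeParam j).IsHomogeneous 1 := by
  fin_cases j
  · exact isHomogeneous_X _ _
  · exact isHomogeneous_X _ _
  · exact isHomogeneous_X _ _
  · exact isHomogeneous_zero _ _ _

theorem mk_mem_line {v : Fin 4 → ℂ} (hv : v ≠ 0) :
    Projectivization.mk ℂ v hv ∈ projZeros (curveEqs 0) ↔ v 0 = 0 ∧ v 3 = 0 := by
  rw [mk_mem_projZeros (isHomogeneous_curveEqs 0)]
  simp [curveEqs]

theorem mk_mem_conic {v : Fin 4 → ℂ} (hv : v ≠ 0) :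
    Projectivization.mk ℂ v hv ∈ projZeros (curveEqs 1) ↔
      v 3 = 0 ∧ v 1 ^ 2 - 2 * (v 0 * v 2) = 0 := by
  rw [mk_mem_projZeros (isHomogeneous_curveEqs 1)]
  simp [curveEqs]

theorem mk_mem_cubic {v : Fin 4 → ℂ} (hv : v ≠ 0) :
    Projectivization.mk ℂ v hv ∈ projZeros (curveEqs 2) ↔
      v 0 ^ 2 - 2 * (v 1 * v 3) = 0 ∧ 3 * (v 2 * v 3) - v 0 * v 1 = 0 ∧
        2 * v 1 ^ 2 - 3 * (v 0 * v 2) = 0 := by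
  rw [mk_mem_projZeros (isHomogeneous_curveEqs 2)]
  simp [curveEqs]

theorem mk_mem_plane {v : Fin 4 → ℂ} (hv : v ≠ 0) :
    Projectivization.mk ℂ v hv ∈ projZeros {X 3} ↔ v 3 = 0 := by
  rw [mk_mem_projZeros (by simpa using ⟨1, isHomogeneous_X _ _⟩)]
  simp

/-- The parametrizations are inverted by reading the ratio `s 0 : s 1` off two coordinates; one
exceptional point is treated separately on the conic and on the cubic. -/
theorem projZeros_curveEqs (i : Fin 3) : projZeros (curveEqs i) = paramSet (curveParam i) := by
  ext x
  induction x using Projectivization.ind with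
  | h v hv =>
  fin_cases i
  · refine (mk_mem_line hv).trans ((mk_mem_paramSet v hv).trans ?_).symm
    constructor
    · rintro ⟨s, c, rfl⟩
      simp [curveParam]
    · rintro ⟨h0, h3⟩
      refine ⟨![v 2 / 2, v 1], 1, funext fun j => ?_⟩
      fin_cases j <;> simp [curveParam, h0, h3]
      ring
  · refine (mk_mem_conic hv).trans ((mk_mem_paramSet v hv).trans ?_).symm
    constructor
    · rintro ⟨s, c, rfl⟩
      simp [curveParam]
      ring
    · rintro ⟨h3, h⟩
      by_cases h2 : v 2 = 0
      · have h1 : v 1 = 0 := by simpa [h2] using h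
        refine ⟨![0, 1], v 0, funext fun j => ?_⟩
        fin_cases j <;> simp [curveParam, h1, h2, h3]
      -- On the conic `v 2 : v 1` equals `s 0 : s 1`; the scalar is fixed by the third coordinate `2
      -- * s 0 ^ 2`.
      · refine ⟨![v 2, v 1], 1 / (2 * v 2), funext fun j => ?_⟩
        fin_cases j <;> simp [curveParam, h3] <;> field_simp
        linear_combination -h
  · refine (mk_mem_cubic hv).trans ((mk_mem_paramSet v hv).trans ?_).symm
    constructor
    · rintro ⟨s, c, rfl⟩
      simp [curveParam]
      refine ⟨by ring, by ring, by ring⟩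
    · rintro ⟨hq, hr, hs⟩
      by_cases h3 : v 3 = 0
      · have h0 : v 0 = 0 := by simpa [h3] using hq
        have h1 : v 1 = 0 := by simpa [h0] using hs
        refine ⟨![1, 0], v 2 / 4, funext fun j => ?_⟩
        fin_cases j <;> simp [curveParam, h0, h1, h3]
      -- On the cubic `v 0 : v 3` equals `2 * s 0 : s 1`; the scalar is fixed by the last coordinate
      -- `3 * s 1 ^ 3`.
      · refine ⟨![v 0, 2 * v 3], 1 / (24 * v 3 ^ 2), funext fun j => ?_⟩
        fin_cases j <;> simp [curveParam] <;> field_simp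
        · ring
        · linear_combination -12 * hq
        · linear_combination 8 * v 3 * hr - 4 * v 0 * hq
        · ring

theorem projZeros_plane : projZeros {X 3} = paramSet planeParam := by
  ext x
  induction x using Projectivization.ind with
  | h v hv =>
  refine (mk_mem_plane hv).trans ((mk_mem_paramSet v hv).trans ?_).symm
  constructor
  · rintro ⟨s, c, rfl⟩
    simp [planeParam]
  · intro h3
    refine ⟨![v 0, v 1, v 2], 1, funext fun j => ?_⟩
    fin_cases j <;> simp [planeParam, h3]

theorem isIrreducibleAlgebraic_curve (i : Fin 3) :
    IsIrreducibleAlgebraic (projZeros (curveEqs i)) := by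
  have hZ : IsAlgebraic (projZeros (curveEqs i)) := ⟨_, isHomogeneous_curveEqs i, rfl⟩
  rw [projZeros_curveEqs] at hZ ⊢
  refine isIrreducibleAlgebraic_paramSet (Nat.succ_pos _) (isHomogeneous_curveParam i) ?_ hZ
  intro h
  have := congrArg (eval fun _ => 1) (congrFun h 2)
  fin_cases i <;> simp [curveParam] at this

theorem isIrreducibleAlgebraic_plane : IsIrreducibleAlgebraic (projZeros {X (3 : Fin 4)}) := by
  have hZ : IsAlgebraic (projZeros {X (3 : Fin 4)}) :=
    ⟨_, by simpa using ⟨1, isHomogeneous_X _ _⟩, rfl⟩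
  rw [projZeros_plane] at hZ ⊢
  refine isIrreducibleAlgebraic_paramSet one_pos isHomogeneous_planeParam ?_ hZ
  intro h
  exact X_ne_zero _ (congrFun h 2)

/-- Up to constants, the pure powers of both parameters occur among the coordinates of each
parametrization. -/
theorem hasDim_curve (i : Fin 3) : HasDim (projZeros (curveEqs i)) 1 := by
  rw [projZeros_curveEqs]
  refine hasDim_paramSet (Nat.succ_pos _) (isHomogeneous_curveParam i) fun j => ?_
  have h : ∀ (k : ℕ) [k.AtLeastTwo] (f : MvPolynomial (Fin 2) ℂ),
      C (1 / (OfNat.ofNat k : ℂ)) * ((OfNat.ofNat k : MvPolynomial (Fin 2) ℂ) * f) = f :=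
    fun k _ f => by
      rw [← map_ofNat C k, ← mul_assoc, ← C_mul, one_div, inv_mul_cancel₀ (OfNat.ofNat_ne_zero k),
        C_1, one_mul]
  fin_cases i <;> fin_cases j
  · exact ⟨C (1 / 2) * X 2, by simpa [curveParam, algebraMap_eq] using h 2 _⟩
  · exact ⟨X 1, by simp [curveParam]⟩
  · exact ⟨C (1 / 2) * X 2, by simpa [curveParam, algebraMap_eq] using h 2 _⟩
  · exact ⟨X 0, by simp [curveParam]⟩
  · exact ⟨C (1 / 4) * X 2, by simpa [curveParam, algebraMap_eq] using h 4 _⟩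
  · exact ⟨C (1 / 3) * X 3, by simpa [curveParam, algebraMap_eq] using h 3 _⟩

theorem hasDim_plane : HasDim (projZeros {X (3 : Fin 4)}) 2 := by
  rw [projZeros_plane]
  refine hasDim_paramSet one_pos isHomogeneous_planeParam fun j => ?_
  fin_cases j
  · exact ⟨X 0, by simp [planeParam]⟩
  · exact ⟨X 1, by simp [planeParam]⟩
  · exact ⟨X 2, by simp [planeParam]⟩

/-- Each curve contains a coordinate point that the other two avoid: `e2` on the line, `e1` on the
conic, `e3` on the cubic. -/
theorem curve_subset_curve (i j : Fin 3) (h : projZeros (curveEqs i) ⊆ projZeros (curveEqs j)) :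
    i = j := by
  have e1 : (![1, 0, 0, 0] : Fin 4 → ℂ) ≠ 0 := fun h => by simpa using congrFun h 0
  have e2 : (![0, 1, 0, 0] : Fin 4 → ℂ) ≠ 0 := fun h => by simpa using congrFun h 1
  have e3 : (![0, 0, 0, 1] : Fin 4 → ℂ) ≠ 0 := fun h => by simpa using congrFun h 3
  fin_cases i <;> fin_cases j
  · rfl
  · simpa using (mk_mem_conic e2).1 (h ((mk_mem_line e2).2 (by simp)))
  · simpa using (mk_mem_cubic e2).1 (h ((mk_mem_line e2).2 (by simp)))
  · simpa using (mk_mem_line e1).1 (h ((mk_mem_conic e1).2 (by simp)))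
  · rfl
  · simpa using (mk_mem_cubic e1).1 (h ((mk_mem_conic e1).2 (by simp)))
  · simpa using (mk_mem_line e3).1 (h ((mk_mem_cubic e3).2 (by simp)))
  · simpa using (mk_mem_conic e3).1 (h ((mk_mem_cubic e3).2 (by simp)))
  · rfl

theorem not_plane_subset_cubic : ¬ projZeros {X (3 : Fin 4)} ⊆ projZeros (curveEqs 2) := by
  intro h
  have e1 : (![1, 0, 0, 0] : Fin 4 → ℂ) ≠ 0 := fun h => by simpa using congrFun h 0
  simpa using (mk_mem_cubic e1).1 (h ((mk_mem_plane e1).2 (by simp)))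

theorem not_cubic_subset_plane : ¬ projZeros (curveEqs 2) ⊆ projZeros {X (3 : Fin 4)} := by
  intro h
  have e3 : (![0, 0, 0, 1] : Fin 4 → ℂ) ≠ 0 := fun h => by simpa using congrFun h 3
  simpa using (mk_mem_plane e3).1 (h ((mk_mem_cubic e3).2 (by simp)))

theorem isHomogeneous_exceptionalForm (i : Fin 4) : (exceptionalForm i).IsHomogeneous 3 := by
  fin_cases i
  · refine isHomogeneous_X_mul ?_ _
    rw [mul_assoc]
    exact (isHomogeneous_X_sq _).ofNat_mul.sub (isHomogeneous_X_mul_X _ _).ofNat_mul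
  · refine isHomogeneous_X_mul ?_ _
    rw [mul_assoc]
    exact (isHomogeneous_X_mul_X _ _).ofNat_mul.sub (isHomogeneous_X_mul_X _ _)
  · refine isHomogeneous_X_mul ?_ _
    rw [mul_assoc]
    exact (isHomogeneous_X_sq _).sub (isHomogeneous_X_mul_X _ _).ofNat_mul
  · refine (IsHomogeneous.add (IsHomogeneous.sub (isHomogeneous_X_mul (isHomogeneous_X_sq _) _) ?_)
      ((isHomogeneous_X_mul_X _ _).mul (isHomogeneous_X _ _))).neg
    rw [mul_assoc]
    exact ((isHomogeneous_X_sq _).mul (isHomogeneous_X _ _)).ofNat_mul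

/-- On `x₃ = 0` only the last coefficient survives, and it factors as `-x₀(x₁² - 2x₀x₂)`: line and
conic. Off this plane the three brackets must vanish; they define the twisted cubic, and the last
coefficient lies in the ideal they generate. -/
theorem eval_exceptionalForm_eq_zero_iff {v : Fin 4 → ℂ} (hv : v ≠ 0) :
    (∀ i, eval v (exceptionalForm i) = 0) ↔
      ∃ i, Projectivization.mk ℂ v hv ∈ projZeros (curveEqs i) := by
  have h : (∀ i, eval v (exceptionalForm i) = 0) ↔
      v 3 * (2 * v 1 ^ 2 - 3 * v 0 * v 2) = 0 ∧ v 3 * (3 * v 2 * v 3 - v 0 * v 1) = 0 ∧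
      v 3 * (v 0 ^ 2 - 2 * v 1 * v 3) = 0 ∧
      -(v 0 * v 1 ^ 2 - 2 * v 0 ^ 2 * v 2 + v 1 * v 2 * v 3) = 0 := by
    rw [Fin.forall_fin_succ, Fin.forall_fin_succ, Fin.forall_fin_succ, Fin.forall_fin_succ]
    simp [exceptionalForm]
  rw [h, Fin.exists_fin_succ, Fin.exists_fin_succ, Fin.exists_fin_one]
  simp only [Fin.succ_zero_eq_one, Fin.succ_one_eq_two, mk_mem_line, mk_mem_conic, mk_mem_cubic]
  constructor
  · rintro ⟨h0, h1, h2, h3⟩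
    by_cases hv3 : v 3 = 0
    · have h4 : v 0 * (v 1 ^ 2 - 2 * (v 0 * v 2)) = 0 := by
        linear_combination -h3 - v 1 * v 2 * hv3
      obtain h | h := mul_eq_zero.1 h4
      · exact Or.inl ⟨h, hv3⟩
      · exact Or.inr (Or.inl ⟨hv3, h⟩)
    · refine Or.inr (Or.inr ⟨?_, ?_, ?_⟩)
      · linear_combination (mul_eq_zero.1 h2).resolve_left hv3
      · linear_combination (mul_eq_zero.1 h1).resolve_left hv3
      · linear_combination (mul_eq_zero.1 h0).resolve_left hv3
  · rintro (⟨h0, h3⟩ | ⟨h3, h⟩ | ⟨hq, hr, hs⟩)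
    · simp [h0, h3]
    · refine ⟨by simp [h3], by simp [h3], by simp [h3], ?_⟩
      rw [h3]
      linear_combination -v 0 * h
    · refine ⟨by linear_combination v 3 * hs, by linear_combination v 3 * hr,
        by linear_combination v 3 * hq, ?_⟩
      linear_combination v 1 * hr + 2 * v 2 * hq

/-! ### Coefficients of binary forms -/

/-- The exponent of `t₀ ^ (k - i) t₁ ^ i`. -/
def binExp (k i : ℕ) : Fin 2 →₀ ℕ := Finsupp.single 0 (k - i) + Finsupp.single 1 i

/-- The binary form `∑ i, a_i t₀ ^ (k - i) t₁ ^ i`. -/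
def ofCoeffs {k : ℕ} (a : Fin (k + 1) → ℂ) : MvPolynomial (Fin 2) ℂ :=
  ∑ i : Fin (k + 1), monomial (binExp k i) (a i)

theorem binExp_inj {k i j : ℕ} : binExp k i = binExp k j ↔ i = j := by
  refine ⟨fun h => ?_, fun h => h ▸ rfl⟩
  simpa [binExp] using DFunLike.congr_fun h 1

theorem coeff_ofCoeffs {k : ℕ} (a : Fin (k + 1) → ℂ) (j : Fin (k + 1)) :
    coeff (binExp k j) (ofCoeffs a) = a j := by
  simp [ofCoeffs, coeff_sum, coeff_monomial, binExp_inj, Fin.val_inj]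

theorem ofCoeffs_eq {k : ℕ} (a : Fin (k + 1) → ℂ) :
    ofCoeffs a = ∑ i : Fin (k + 1), C (a i) * (X 0 ^ (k - i) * X 1 ^ (i : ℕ)) := by
  refine Finset.sum_congr rfl fun i _ => ?_
  rw [X_pow_eq_monomial, X_pow_eq_monomial, monomial_mul, C_mul_monomial, mul_one, mul_one, binExp]

theorem isHomogeneous_ofCoeffs {k : ℕ} (a : Fin (k + 1) → ℂ) : (ofCoeffs a).IsHomogeneous k := by
  refine IsHomogeneous.sum _ _ _ fun i _ => isHomogeneous_monomial _ ?_
  have := i.2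
  rw [binExp, map_add, Finsupp.degree_single, Finsupp.degree_single]
  omega

theorem _root_.MvPolynomial.IsHomogeneous.eq_ofCoeffs {k : ℕ} {h : MvPolynomial (Fin 2) ℂ}
    (hh : h.IsHomogeneous k) : h = ofCoeffs fun i : Fin (k + 1) => coeff (binExp k i) h := by
  ext m
  by_cases hm : m.degree = k
  · rw [Finsupp.degree_eq_sum, Fin.sum_univ_two] at hm
    have hm1 : m 1 < k + 1 := by omega
    have : m = binExp k (⟨m 1, hm1⟩ : Fin (k + 1)) := by
      ext i
      fin_cases i <;> simp [binExp]
      omega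
    rw [this, coeff_ofCoeffs]
  · rw [hh.coeff_eq_zero hm, (isHomogeneous_ofCoeffs _).coeff_eq_zero hm]

/-- A binary form of degree `k` is determined by its `k + 1` coefficients. -/
def coeffEquiv (k : ℕ) : BinForm k ≃ₗ[ℂ] (Fin (k + 1) → ℂ) where
  toFun h i := coeff (binExp k i) (h : MvPolynomial (Fin 2) ℂ)
  map_add' _ _ := funext fun _ => coeff_add _ _ _
  map_smul' _ _ := funext fun _ => coeff_smul _ _ _
  invFun a := ⟨ofCoeffs a, (mem_homogeneousSubmodule _ _).2 (isHomogeneous_ofCoeffs a)⟩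
  left_inv h := Subtype.ext
    (((mem_homogeneousSubmodule _ _).1 h.2).eq_ofCoeffs).symm
  right_inv a := funext fun i => coeff_ofCoeffs a i

theorem finrank_binForm (k : ℕ) : Module.finrank ℂ (BinForm k) = k + 1 := by
  rw [(coeffEquiv k).finrank_eq]
  simp

theorem BinForm.isHomogeneous {k : ℕ} (h : BinForm k) :
    (h : MvPolynomial (Fin 2) ℂ).IsHomogeneous k :=
  (mem_homogeneousSubmodule _ _).1 h.2

/-! ### Frames of linear forms -/

/-- The linear form `a t₀ + b t₁`. -/
def linForm (a b : ℂ) : MvPolynomial (Fin 2) ℂ := C a * X 0 + C b * X 1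

theorem isHomogeneous_linForm (a b : ℂ) : (linForm a b).IsHomogeneous 1 :=
  (isHomogeneous_C_mul_X _ _).add (isHomogeneous_C_mul_X _ _)

theorem eval_linForm (a b : ℂ) (x : Fin 2 → ℂ) : eval x (linForm a b) = a * x 0 + b * x 1 := by
  simp [linForm]

theorem exists_eq_linForm (l : BinForm 1) :
    ∃ a b, (l : MvPolynomial (Fin 2) ℂ) = linForm a b := by
  refine ⟨coeff (binExp 1 0) (l : MvPolynomial (Fin 2) ℂ),
    coeff (binExp 1 1) (l : MvPolynomial (Fin 2) ℂ), ?_⟩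
  conv_lhs => rw [l.isHomogeneous.eq_ofCoeffs, ofCoeffs_eq]
  simp [Fin.sum_univ_two, linForm]

/-- Determinant one, rather than merely nonzero, keeps powers of the determinant out of the formulas
for `Q` and `C`. -/
theorem exists_frame {v : BinForm 1} (hv : v ≠ 0) :
    ∃ α β γ δ : ℂ, α * δ - β * γ = 1 ∧ (v : MvPolynomial (Fin 2) ℂ) = linForm α β := by
  obtain ⟨α, β, h⟩ := exists_eq_linForm v
  by_cases hα : α = 0
  · have hβ : β ≠ 0 := by
      rintro rfl
      exact hv (Subtype.ext (by simp [h, hα, linForm]))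
    exact ⟨α, β, -1 / β, 0, by field_simp; ring, h⟩
  · exact ⟨α, β, 0, 1 / α, by field_simp; ring, h⟩

/-- The expansion of a binary form with respect to a unimodular frame of linear forms. -/
theorem exists_expansion {α β γ δ : ℂ} (hdet : α * δ - β * γ = 1) {k : ℕ}
    {h : MvPolynomial (Fin 2) ℂ} (hh : h.IsHomogeneous k) :
    ∃ c : Fin (k + 1) → ℂ,
      h = ∑ i : Fin (k + 1), C (c i) * (linForm α β ^ (k - i) * linForm γ δ ^ (i : ℕ)) := by
  -- The substitution by the inverse matrix expresses `h` in the frame; the coefficients of the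
  -- result are those sought.
  have hτ : (aeval (R := ℂ) ![linForm δ (-β), linForm (-γ) α] h).IsHomogeneous k := by
    have := hh.aeval ![linForm δ (-β), linForm (-γ) α] (n := 1) fun i => by
      fin_cases i <;> exact isHomogeneous_linForm _ _
    rwa [one_mul] at this
  have h1 := congrArg (aeval (R := ℂ) ![linForm α β, linForm γ δ]) (hτ.eq_ofCoeffs.trans
    (ofCoeffs_eq _))
  have h2 : aeval (R := ℂ) ![linForm α β, linForm γ δ]
      (aeval (R := ℂ) ![linForm δ (-β), linForm (-γ) α] h) = h := by
    have : (aeval (R := ℂ) ![linForm α β, linForm γ δ]).comp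
        (aeval (R := ℂ) ![linForm δ (-β), linForm (-γ) α]) = AlgHom.id ℂ _ := by
      ext1 i
      fin_cases i
      · refine MvPolynomial.funext fun x => ?_
        simp [linForm, algebraMap_eq]
        linear_combination x 0 * hdet
      · refine MvPolynomial.funext fun x => ?_
        simp [linForm, algebraMap_eq]
        linear_combination x 1 * hdet
    exact congrArg (fun f => f h) this
  rw [h2] at h1
  exact ⟨_, by simpa [algebraMap_eq] using h1⟩

theorem linForm_ne_zero {α β γ δ : ℂ} (hdet : α * δ - β * γ = 1) : linForm α β ≠ 0 := by
  intro h
  have h0 := congrArg (eval ![1, 0]) h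
  have h1 := congrArg (eval ![0, 1]) h
  simp [eval_linForm] at h0 h1
  simp [h0, h1] at hdet

/-! ### Splitting of binary forms -/

/-- Either the coefficient of `t₀^(k+1)` vanishes and `(1, 0)` is a zero, or `h(t, 1)` is a
nonconstant polynomial in `t` and has a root. -/
theorem exists_zero_of_isHomogeneous {k : ℕ} {h : MvPolynomial (Fin 2) ℂ}
    (hh : h.IsHomogeneous (k + 1)) : ∃ x : Fin 2 → ℂ, x ≠ 0 ∧ eval x h = 0 := by
  obtain ⟨a, he⟩ : ∃ a : Fin (k + 2) → ℂ,
      h = ∑ i : Fin (k + 2), C (a i) * (X 0 ^ (k + 1 - (i : ℕ)) * X 1 ^ (i : ℕ)) :=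
    ⟨_, hh.eq_ofCoeffs.trans (ofCoeffs_eq _)⟩
  by_cases h0 : a 0 = 0
  · refine ⟨![1, 0], fun h => by simpa using congrFun h 0, ?_⟩
    rw [he, map_sum, Fin.sum_univ_succ]
    simp [h0]
  · let P : Polynomial ℂ := ∑ i : Fin (k + 2), Polynomial.C (a i) * Polynomial.X ^ (k + 1 - (i : ℕ))
    have hP : P.coeff (k + 1) = a 0 := by
      simp only [P, Polynomial.finsetSum_coeff, Polynomial.coeff_C_mul_X_pow]
      rw [Fin.sum_univ_succ]
      simp
      refine Finset.sum_eq_zero fun i _ => ?_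
      rw [if_neg]
      omega
    have hdeg : P.degree ≠ 0 := by
      intro hd
      have : P.natDegree = 0 := Polynomial.natDegree_eq_of_degree_eq_some hd
      have h1 : P.coeff (k + 1) = 0 := Polynomial.coeff_eq_zero_of_natDegree_lt (by omega)
      exact h0 (hP ▸ h1)
    obtain ⟨t, ht⟩ := IsAlgClosed.exists_root P hdeg
    refine ⟨![t, 1], fun h => by simpa using congrFun h 1, ?_⟩
    rw [Polynomial.IsRoot.def, Polynomial.eval_finsetSum] at ht
    rw [he, map_sum, ← ht]
    simp

/-- A zero `x` of `h` gives a linear form `v` vanishing at `x`; expanding `h` in a frame `v, w`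
shows that `v` splits off. -/
theorem exists_eq_prod {k : ℕ} {h : MvPolynomial (Fin 2) ℂ} (hh : h.IsHomogeneous k)
    (h0 : h ≠ 0) : ∃ (q : Fin k → PForm 1) (c : ℂ), c ≠ 0 ∧
      h = C c * ∏ i, ((q i).rep : MvPolynomial (Fin 2) ℂ) := by
  induction k generalizing h with
  | zero =>
    rw [← totalDegree_zero_iff_isHomogeneous, totalDegree_eq_zero_iff_eq_C] at hh
    refine ⟨Fin.elim0, coeff 0 h, fun h' => h0 ?_, by simpa using hh⟩
    rw [hh, h', C_0]
  | succ k ih =>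
    obtain ⟨x, hx, hxh⟩ := exists_zero_of_isHomogeneous hh
    let l : BinForm 1 := ⟨linForm (x 1) (-x 0), (mem_homogeneousSubmodule _ _).2
      (isHomogeneous_linForm _ _)⟩
    have hl : l ≠ 0 := by
      intro hl
      have hl' : linForm (x 1) (-x 0) = 0 := congrArg Subtype.val hl
      have e0 := congrArg (eval ![1, 0]) hl'
      have e1 := congrArg (eval ![0, 1]) hl'
      simp [eval_linForm] at e0 e1
      refine hx (funext fun i => ?_)
      fin_cases i
      · exact e1
      · exact e0
    let q₀ : PForm 1 := Projectivization.mk ℂ l hl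
    obtain ⟨α, β, γ, δ, hdet, hv⟩ := exists_frame q₀.rep_nonzero
    have hvx : α * x 0 + β * x 1 = 0 := by
      obtain ⟨a, ha⟩ := Projectivization.exists_smul_eq_mk_rep ℂ l hl
      have : linForm α β = (a : ℂ) • linForm (x 1) (-x 0) := by
        rw [← hv]
        exact congrArg Subtype.val ha.symm
      rw [← eval_linForm, this, smul_eval, eval_linForm]
      ring
    have hwx : γ * x 0 + δ * x 1 ≠ 0 := by
      intro hwx
      refine hx (funext fun i => ?_)
      fin_cases i
      · change x 0 = 0
        linear_combination -x 0 * hdet + δ * hvx - β * hwx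
      · change x 1 = 0
        linear_combination -x 1 * hdet - γ * hvx + α * hwx
    obtain ⟨c, hc⟩ := exists_expansion hdet hh
    -- At `x` every term containing `v` vanishes, while `w` does not; so the coefficient of
    -- `w^(k+1)` is zero.
    have hlast : c (Fin.last (k + 1)) = 0 := by
      have := hxh
      rw [hc, map_sum, Fin.sum_univ_castSucc, Finset.sum_eq_zero] at this
      · simpa [eval_linForm, hwx] using this
      · intro i _
        have : k + 1 - (i : ℕ) ≠ 0 := by omega
        simp [eval_linForm, hvx, this]
    let h' : MvPolynomial (Fin 2) ℂ :=
      ∑ i : Fin (k + 1), C (c i.castSucc) * (linForm α β ^ (k - i) * linForm γ δ ^ (i : ℕ))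
    have hh' : h'.IsHomogeneous k := by
      refine IsHomogeneous.sum _ _ _ fun i _ => IsHomogeneous.C_mul ?_ _
      have := ((isHomogeneous_linForm α β).pow (k - i)).mul ((isHomogeneous_linForm γ δ).pow i)
      rwa [one_mul, one_mul, Nat.sub_add_cancel (by omega)] at this
    have heq : h = linForm α β * h' := by
      rw [hc, Fin.sum_univ_castSucc, hlast, C_0, zero_mul, add_zero, Finset.mul_sum]
      refine Finset.sum_congr rfl fun i _ => ?_
      rw [Fin.val_castSucc, show k + 1 - (i : ℕ) = (k - i) + 1 by omega, pow_succ]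
      ring
    obtain ⟨q, e, he, hq⟩ := ih hh' (by rintro h; exact h0 (by rw [heq, h, mul_zero]))
    refine ⟨Fin.cons q₀ q, e, he, ?_⟩
    rw [heq, hq, Fin.prod_univ_succ]
    simp only [Fin.cons_zero, Fin.cons_succ, hv]
    ring

theorem mk_eq_divisor_iff {r : ℕ} {F : BinForm r} (hF : F ≠ 0) (q : Fin r → PForm 1) :
    Projectivization.mk ℂ F hF = divisor q ↔ ∃ c : ℂ, c ≠ 0 ∧ (F : MvPolynomial (Fin 2) ℂ) =
      C c * ∏ i, ((q i).rep : MvPolynomial (Fin 2) ℂ) := by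
  rw [divisor, Projectivization.mk_eq_mk_iff]
  constructor
  · rintro ⟨a, ha⟩
    refine ⟨a, a.ne_zero, ?_⟩
    rw [← ha, ← smul_eq_C_mul]
    rfl
  · rintro ⟨c, hc, h⟩
    refine ⟨Units.mk0 c hc, Subtype.ext ?_⟩
    rw [h, ← smul_eq_C_mul]
    rfl

theorem eq_divisor_iff {r : ℕ} (x : PForm r) (q : Fin r → PForm 1) :
    x = divisor q ↔ ∃ c : ℂ, c ≠ 0 ∧ (x.rep : MvPolynomial (Fin 2) ℂ) =
      C c * ∏ i, ((q i).rep : MvPolynomial (Fin 2) ℂ) := by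
  conv_lhs => rw [← x.mk_rep]
  exact mk_eq_divisor_iff _ _

/-! ### Osculating spaces -/

/-- Multiplication with a binary form of degree `d`. -/
def mulForm {u : MvPolynomial (Fin 2) ℂ} {d k r : ℕ} (hu : u.IsHomogeneous d) (h : d + k = r) :
    BinForm k →ₗ[ℂ] BinForm r where
  toFun f := ⟨u * f, (mem_homogeneousSubmodule _ _).2 (h ▸ hu.mul f.isHomogeneous)⟩
  map_add' _ _ := Subtype.ext (mul_add _ _ _)
  map_smul' _ _ := Subtype.ext (mul_smul_comm _ _ _)

theorem mulForm_injective {u : MvPolynomial (Fin 2) ℂ} {d k r : ℕ} (hu : u.IsHomogeneous d)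
    (h : d + k = r) (hu0 : u ≠ 0) : Function.Injective (mulForm hu h) := fun _ _ hfg =>
  Subtype.ext (mul_left_cancel₀ hu0 (congrArg Subtype.val hfg))

theorem coeff_frame_pow (v w : MvPolynomial (Fin 2) ℂ) {r j : ℕ} (hj : j ≤ r) :
    ((Polynomial.C v + Polynomial.C w * Polynomial.X) ^ r).coeff j =
      C (r.choose j : ℂ) * (v ^ (r - j) * w ^ j) := by
  rw [add_comm, add_pow, Polynomial.finsetSum_coeff, Finset.sum_eq_single j]
  · have : (Polynomial.C w * Polynomial.X) ^ j * Polynomial.C v ^ (r - j) *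
        ((r.choose j : ℕ) : Polynomial (MvPolynomial (Fin 2) ℂ)) =
        Polynomial.C ((r.choose j : MvPolynomial (Fin 2) ℂ) * (v ^ (r - j) * w ^ j)) *
          Polynomial.X ^ j := by
      simp only [map_mul, map_pow, map_natCast]
      ring
    rw [this, Polynomial.coeff_C_mul_X_pow, if_pos rfl, map_natCast]
  · intro i _ hi
    have : (Polynomial.C w * Polynomial.X) ^ i * Polynomial.C v ^ (r - i) *
        ((r.choose i : ℕ) : Polynomial (MvPolynomial (Fin 2) ℂ)) =
        Polynomial.C ((r.choose i : MvPolynomial (Fin 2) ℂ) * (v ^ (r - i) * w ^ i)) *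
          Polynomial.X ^ i := by
      simp only [map_mul, map_pow, map_natCast]
      ring
    rw [this, Polynomial.coeff_C_mul_X_pow, if_neg (Ne.symm hi)]
  · intro h
    exact absurd (Finset.mem_range.2 (by omega)) h

theorem isHomogeneous_rep_pow (p : PForm 1) (d : ℕ) :
    ((p.rep : MvPolynomial (Fin 2) ℂ) ^ d).IsHomogeneous d := by
  simpa using p.rep.isHomogeneous.pow d

theorem rep_coe_ne_zero (p : PForm 1) : (p.rep : MvPolynomial (Fin 2) ℂ) ≠ 0 := fun h =>
  p.rep_nonzero (Subtype.ext h)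

/-- Taylor coefficients of order at most `k` are divisible by `v^(r-k)`. Conversely, a single `w`
completing `v` to a frame already yields all `v^(r-i) w^i` with `i ≤ k`, since the binomial
coefficients are invertible in `ℂ`. -/
theorem osculatingSpace_eq_range {r d k : ℕ} (h : d + k = r) (p : PForm 1) :
    osculatingSpace r k p = LinearMap.range (mulForm (isHomogeneous_rep_pow p d) h) := by
  refine le_antisymm (Submodule.span_le.2 ?_) ?_
  · rintro F ⟨w, j, hj, hF⟩
    rw [coeff_frame_pow _ _ (by omega)] at hF
    have hm : (C (r.choose j : ℂ) * ((p.rep : MvPolynomial (Fin 2) ℂ) ^ (k - j) *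
        (w : MvPolynomial (Fin 2) ℂ) ^ j)).IsHomogeneous k := by
      have := ((p.rep.isHomogeneous.pow (k - j)).mul (w.isHomogeneous.pow j)).C_mul
        (r.choose j : ℂ)
      rwa [one_mul, one_mul, Nat.sub_add_cancel hj] at this
    refine ⟨⟨_, (mem_homogeneousSubmodule _ _).2 hm⟩, Subtype.ext ?_⟩
    rw [hF]
    change _ * (C _ * (_ * _)) = _
    rw [show r - j = d + (k - j) by omega, pow_add]
    ring
  · rintro _ ⟨f, rfl⟩
    obtain ⟨α, β, γ, δ, hdet, hv⟩ := exists_frame p.rep_nonzero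
    obtain ⟨c, hc⟩ := exists_expansion hdet f.isHomogeneous
    have hmem : ((mulForm (isHomogeneous_rep_pow p d) h f : BinForm r) :
        MvPolynomial (Fin 2) ℂ) ∈ (osculatingSpace r k p).map (Submodule.subtype _) := by
      change (p.rep : MvPolynomial (Fin 2) ℂ) ^ d * (f : MvPolynomial (Fin 2) ℂ) ∈ _
      rw [hc, Finset.mul_sum]
      refine Submodule.sum_mem _ fun i _ => ?_
      have hi : (i : ℕ) ≤ k := by omega
      let w : BinForm 1 := ⟨linForm γ δ, (mem_homogeneousSubmodule _ _).2
        (isHomogeneous_linForm _ _)⟩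
      have hG : (C (r.choose i : ℂ) * ((p.rep : MvPolynomial (Fin 2) ℂ) ^ (r - i) *
          (w : MvPolynomial (Fin 2) ℂ) ^ (i : ℕ))).IsHomogeneous r := by
        have := ((p.rep.isHomogeneous.pow (r - i)).mul (w.isHomogeneous.pow i)).C_mul
          (r.choose i : ℂ)
        rwa [one_mul, one_mul, Nat.sub_add_cancel (by omega)] at this
      have hG' : (⟨_, (mem_homogeneousSubmodule _ _).2 hG⟩ : BinForm r) ∈ osculatingSpace r k p :=
        Submodule.subset_span ⟨w, i, hi, (coeff_frame_pow _ _ (by omega)).symm⟩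
      have hch : (r.choose i : ℂ) ≠ 0 :=
        Nat.cast_ne_zero.2 (Nat.choose_pos (by omega)).ne'
      refine ⟨(c i / r.choose i) • ⟨_, (mem_homogeneousSubmodule _ _).2 hG⟩,
        Submodule.smul_mem _ _ hG', ?_⟩
      change (c i / r.choose i) • (C (r.choose i : ℂ) * (_ * linForm γ δ ^ (i : ℕ))) = _
      rw [smul_eq_C_mul, ← mul_assoc, ← C_mul, div_mul_cancel₀ _ hch, hv,
        show r - (i : ℕ) = d + (k - i) by omega, pow_add]
      ring
    obtain ⟨y, hy, hy'⟩ := hmem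
    rwa [← Subtype.ext hy']

theorem finrank_osculatingSpace {r k : ℕ} (h : k ≤ r) (p : PForm 1) :
    Module.finrank ℂ (osculatingSpace r k p) = k + 1 := by
  rw [osculatingSpace_eq_range (Nat.sub_add_cancel h),
    LinearMap.finrank_range_of_inj (mulForm_injective _ _ (pow_ne_zero _ (rep_coe_ne_zero p))),
    finrank_binForm]

theorem mem_osculatingSpace_iff {r d k : ℕ} (h : d + k = r) (p : PForm 1) (F : BinForm r) :
    F ∈ osculatingSpace r k p ↔ ∃ f : BinForm k, (F : MvPolynomial (Fin 2) ℂ) =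
      (p.rep : MvPolynomial (Fin 2) ℂ) ^ d * (f : MvPolynomial (Fin 2) ℂ) := by
  rw [osculatingSpace_eq_range h]
  exact ⟨fun ⟨f, hf⟩ => ⟨f, congrArg Subtype.val hf.symm⟩,
    fun ⟨f, hf⟩ => ⟨f, Subtype.ext hf.symm⟩⟩

/-- The cofactor of `v^d` splits into linear forms, which turns divisibility into a statement about
divisors. -/
theorem mem_osculatingPlane_iff {r d k : ℕ} (h : d + k = r) (p : PForm 1) (x : PForm r) :
    x ∈ osculatingPlane r k p ↔ ∃ (q : Fin k → PForm 1) (c : ℂ), c ≠ 0 ∧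
      (x.rep : MvPolynomial (Fin 2) ℂ) = C c * ((p.rep : MvPolynomial (Fin 2) ℂ) ^ d *
        ∏ i, ((q i).rep : MvPolynomial (Fin 2) ℂ)) := by
  refine (mem_osculatingSpace_iff h p x.rep).trans ⟨?_, ?_⟩
  · rintro ⟨f, hf⟩
    have hf0 : (f : MvPolynomial (Fin 2) ℂ) ≠ 0 := by
      intro h0
      exact x.rep_nonzero (Subtype.ext (by simpa [h0] using hf))
    obtain ⟨q, c, hc, hq⟩ := exists_eq_prod f.isHomogeneous hf0
    exact ⟨q, c, hc, by rw [hf, hq]; ring⟩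
  · rintro ⟨q, c, -, hx⟩
    exact ⟨c • divisorForm q, by
      rw [hx]
      change _ = _ * (c • ∏ i, ((q i).rep : MvPolynomial (Fin 2) ℂ))
      rw [smul_eq_C_mul]
      ring⟩

theorem mk_mem_osculatingPlane_iff {r k : ℕ} (p : PForm 1) {F : BinForm r} (hF : F ≠ 0) :
    Projectivization.mk ℂ F hF ∈ osculatingPlane r k p ↔ F ∈ osculatingSpace r k p := by
  obtain ⟨a, ha⟩ := Projectivization.exists_smul_eq_mk_rep ℂ F hF
  change (Projectivization.mk ℂ F hF).rep ∈ osculatingSpace r k p ↔ _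
  rw [← ha, Units.smul_def]
  exact Submodule.smul_mem_iff _ a.ne_zero

theorem osculatingPlane_one_eq (p : PForm 1) :
    osculatingPlane 4 1 p = {x | ∃ q, x = divisor ![p, p, p, q]} := by
  ext x
  rw [mem_osculatingPlane_iff (r := 4) (d := 3) rfl]
  simp only [Set.mem_ofPred_eq, eq_divisor_iff, Fin.prod_univ_four, Fin.prod_univ_one,
    Matrix.cons_val]
  constructor
  · rintro ⟨q, c, hc, hx⟩
    exact ⟨q 0, c, hc, by rw [hx]; ring⟩
  · rintro ⟨q, c, hc, hx⟩
    exact ⟨fun _ => q, c, hc, by rw [hx]; ring⟩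

theorem osculatingPlane_two_eq (p : PForm 1) :
    osculatingPlane 4 2 p = {x | ∃ q r, x = divisor ![p, p, q, r]} := by
  ext x
  rw [mem_osculatingPlane_iff (r := 4) (d := 2) rfl]
  simp only [Set.mem_ofPred_eq, eq_divisor_iff, Fin.prod_univ_four, Fin.prod_univ_two,
    Matrix.cons_val]
  constructor
  · rintro ⟨q, c, hc, hx⟩
    exact ⟨q 0, q 1, c, hc, by rw [hx]; ring⟩
  · rintro ⟨q, r, c, hc, hx⟩
    exact ⟨![q, r], c, hc, by rw [hx]; simp only [Matrix.cons_val]; ring⟩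

theorem osculatingPlane_three_eq (p : PForm 1) :
    osculatingPlane 4 3 p = {x | ∃ q r s, x = divisor ![p, q, r, s]} := by
  ext x
  rw [mem_osculatingPlane_iff (r := 4) (d := 1) rfl]
  simp only [Set.mem_ofPred_eq, eq_divisor_iff, Fin.prod_univ_four, Fin.prod_univ_three,
    Matrix.cons_val]
  constructor
  · rintro ⟨q, c, hc, hx⟩
    exact ⟨q 0, q 1, q 2, c, hc, by rw [hx]; ring⟩
  · rintro ⟨q, r, s, c, hc, hx⟩
    exact ⟨![q, r, s], c, hc, by rw [hx]; simp only [Matrix.cons_val]; ring⟩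

theorem exists_conicAt_eq (p : PForm 1) :
    ∃ (f : BinForm 2 →ₗ[ℂ] BinForm 4) (hf : Function.Injective f),
      LinearMap.range f = osculatingSpace 4 2 p ∧
      conicAt p = Projectivization.map f hf '' veroneseCurve 2 := by
  refine ⟨mulForm (isHomogeneous_rep_pow p 2) rfl,
    mulForm_injective _ _ (pow_ne_zero _ (rep_coe_ne_zero p)),
    (osculatingSpace_eq_range rfl p).symm, ?_⟩
  rw [veroneseCurve, ← Set.range_comp]
  ext x
  refine exists_congr fun q => ?_
  rw [eq_comm, Function.comp_apply]
  refine Eq.congr ?_ rfl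
  refine (Projectivization.mk_eq_mk_iff' ℂ _ _ _ _).2 ⟨1, Subtype.ext ?_⟩
  rw [one_smul]
  change (p.rep : MvPolynomial (Fin 2) ℂ) ^ 2 * ∏ _i : Fin 2, (q.rep : MvPolynomial (Fin 2) ℂ) =
    ∏ i, ((![p, p, q, q] i).rep : MvPolynomial (Fin 2) ℂ)
  simp only [Fin.prod_univ_four, Fin.prod_univ_two, Matrix.cons_val]
  ring

theorem exists_cubicAt_eq (p : PForm 1) :
    ∃ (f : BinForm 3 →ₗ[ℂ] BinForm 4) (hf : Function.Injective f),
      LinearMap.range f = osculatingSpace 4 3 p ∧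
      cubicAt p = Projectivization.map f hf '' veroneseCurve 3 := by
  refine ⟨mulForm (isHomogeneous_rep_pow p 1) rfl,
    mulForm_injective _ _ (pow_ne_zero _ (rep_coe_ne_zero p)),
    (osculatingSpace_eq_range rfl p).symm, ?_⟩
  rw [veroneseCurve, ← Set.range_comp]
  ext x
  refine exists_congr fun q => ?_
  rw [eq_comm, Function.comp_apply]
  refine Eq.congr ?_ rfl
  refine (Projectivization.mk_eq_mk_iff' ℂ _ _ _ _).2 ⟨1, Subtype.ext ?_⟩
  rw [one_smul]
  change (p.rep : MvPolynomial (Fin 2) ℂ) ^ 1 * ∏ _i : Fin 3, (q.rep : MvPolynomial (Fin 2) ℂ) =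
    ∏ i, ((![p, q, q, q] i).rep : MvPolynomial (Fin 2) ℂ)
  simp only [Fin.prod_univ_four, Fin.prod_univ_three, Matrix.cons_val]
  ring

/-! ### Adapted coordinates on the osculating hyperplane -/

/-- The cubic form with coordinates `y` with respect to the frame `v`, `w`. -/
def frameCubic (v w : MvPolynomial (Fin 2) ℂ) (y : Fin 4 → ℂ) : MvPolynomial (Fin 2) ℂ :=
  C (3 * y 2) * v ^ 3 + C (6 * y 1) * (v ^ 2 * w) + C (6 * y 0) * (v * w ^ 2) + C (4 * y 3) * w ^ 3

theorem isHomogeneous_frameCubic {v w : MvPolynomial (Fin 2) ℂ} (hv : v.IsHomogeneous 1)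
    (hw : w.IsHomogeneous 1) (y : Fin 4 → ℂ) : (frameCubic v w y).IsHomogeneous 3 :=
  ((((hv.pow 3).C_mul _).add (((hv.pow 2).mul hw).C_mul _)).add
    ((hv.mul (hw.pow 2)).C_mul _)).add ((hw.pow 3).C_mul _)

/-- The quartic forms divisible by `v`, in coordinates adapted to the frame `v`, `w`. -/
def frameMap {v w : MvPolynomial (Fin 2) ℂ} (hv : v.IsHomogeneous 1) (hw : w.IsHomogeneous 1) :
    (Fin 4 → ℂ) →ₗ[ℂ] BinForm 4 where
  toFun y := ⟨v * frameCubic v w y, (mem_homogeneousSubmodule _ _).2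
    (hv.mul (isHomogeneous_frameCubic hv hw y))⟩
  map_add' y z := Subtype.ext (by
    change v * frameCubic v w (y + z) = v * frameCubic v w y + v * frameCubic v w z
    simp only [frameCubic, Pi.add_apply, mul_add, C_add]
    ring)
  map_smul' c y := Subtype.ext (by
    change v * frameCubic v w (c • y) = c • (v * frameCubic v w y)
    simp only [frameCubic, Pi.smul_apply, smul_eq_mul, C_mul, smul_eq_C_mul]
    ring)

theorem coe_frameMap {v w : MvPolynomial (Fin 2) ℂ} (hv : v.IsHomogeneous 1)
    (hw : w.IsHomogeneous 1) (y : Fin 4 → ℂ) :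
    (frameMap hv hw y : MvPolynomial (Fin 2) ℂ) = v * frameCubic v w y := rfl

section Frame

variable {α β γ δ : ℂ}

theorem frameMap_injective (hdet : α * δ - β * γ = 1) : Function.Injective
    (frameMap (isHomogeneous_linForm α β) (isHomogeneous_linForm γ δ)) := by
  rw [injective_iff_map_eq_zero]
  intro y hy
  have h0 : linForm α β * frameCubic (linForm α β) (linForm γ δ) y = 0 := congrArg Subtype.val hy
  replace h0 := (mul_eq_zero.1 h0).resolve_left (linForm_ne_zero hdet)
  have hev : ∀ a b : ℂ, 3 * y 2 * a ^ 3 + 6 * y 1 * (a ^ 2 * b) + 6 * y 0 * (a * b ^ 2) +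
      4 * y 3 * b ^ 3 = 0 := fun a b => by
    -- At this point the two frame forms take the values `a` and `b`.
    have h := congrArg (eval ![δ * a - β * b, α * b - γ * a]) h0
    have ha : α * (δ * a - β * b) + β * (α * b - γ * a) = a := by linear_combination a * hdet
    have hb : γ * (δ * a - β * b) + δ * (α * b - γ * a) = b := by linear_combination b * hdet
    simpa [frameCubic, eval_linForm, ha, hb] using h
  have e1 := hev 1 0
  have e2 := hev 0 1
  have e3 := hev 1 1
  have e4 := hev 1 (-1)
  funext i
  fin_cases i
  · change y 0 = 0
    linear_combination (e3 + e4) / 12 - e1 / 6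
  · change y 1 = 0
    linear_combination (e3 - e4) / 12 - e2 / 6
  · change y 2 = 0
    linear_combination e1 / 3
  · change y 3 = 0
    linear_combination e2 / 4

theorem range_frameMap (hdet : α * δ - β * γ = 1) {p : PForm 1}
    (hp : (p.rep : MvPolynomial (Fin 2) ℂ) = linForm α β) :
    LinearMap.range (frameMap (isHomogeneous_linForm α β) (isHomogeneous_linForm γ δ)) =
      osculatingSpace 4 3 p := by
  ext F
  rw [mem_osculatingSpace_iff (r := 4) (d := 1) rfl, LinearMap.mem_range, hp]
  constructor
  · rintro ⟨y, rfl⟩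
    exact ⟨⟨_, (mem_homogeneousSubmodule _ _).2
      (isHomogeneous_frameCubic (isHomogeneous_linForm α β) (isHomogeneous_linForm γ δ) y)⟩,
      by rw [coe_frameMap, pow_one]⟩
  · rintro ⟨f, hf⟩
    obtain ⟨c, hc⟩ := exists_expansion hdet f.isHomogeneous
    -- `c i` belongs to `v^(3-i) w^i`; the order and the denominators undo the labelling and the
    -- weights 3, 6, 6, 4 of `frameCubic`.
    refine ⟨![c 2 / 6, c 1 / 6, c 0 / 3, c 3 / 4], Subtype.ext ?_⟩
    rw [coe_frameMap, hf, hc, pow_one, Fin.sum_univ_four]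
    refine MvPolynomial.funext fun x => ?_
    simp [frameCubic, -mul_eq_mul_left_iff]
    ring

/-- Up to a factor 4, `y 3` is the coefficient of `w³` in the cubic cofactor, the only obstruction
to a second factor `v`. -/
theorem frameMap_mem_osculatingSpace_two (hdet : α * δ - β * γ = 1) {p : PForm 1}
    (hp : (p.rep : MvPolynomial (Fin 2) ℂ) = linForm α β) (y : Fin 4 → ℂ) :
    frameMap (isHomogeneous_linForm α β) (isHomogeneous_linForm γ δ) y ∈
      osculatingSpace 4 2 p ↔ y 3 = 0 := by
  rw [mem_osculatingSpace_iff (r := 4) (d := 2) rfl, hp]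
  constructor
  · rintro ⟨f, hf⟩
    obtain ⟨c, hc⟩ := exists_expansion hdet f.isHomogeneous
    have : y = ![c 2 / 6, c 1 / 6, c 0 / 3, 0] := by
      refine frameMap_injective hdet (Subtype.ext ?_)
      rw [hf, coe_frameMap, hc, Fin.sum_univ_three]
      refine MvPolynomial.funext fun x => ?_
      simp [frameCubic]
      ring
    rw [this]
    rfl
  · intro h
    refine ⟨⟨C (3 * y 2) * linForm α β ^ 2 + C (6 * y 1) * (linForm α β * linForm γ δ) +
      C (6 * y 0) * linForm γ δ ^ 2, (mem_homogeneousSubmodule _ _).2 ?_⟩, ?_⟩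
    · exact ((((isHomogeneous_linForm α β).pow 2).C_mul _).add
        (((isHomogeneous_linForm α β).mul (isHomogeneous_linForm γ δ)).C_mul _)).add
        (((isHomogeneous_linForm γ δ).pow 2).C_mul _)
    · rw [coe_frameMap, frameCubic, h, mul_zero, C_0]
      ring

/-- The points `(3 - i) p + (i + 1) q`, `q ∈ P(1)`, are parametrized by `curveParam i`. -/
theorem exists_frameMap_eq_iff (hdet : α * δ - β * γ = 1) {p : PForm 1}
    (hp : (p.rep : MvPolynomial (Fin 2) ℂ) = linForm α β) (i : Fin 3) {y : Fin 4 → ℂ}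
    (hy : y ≠ 0) :
    (∃ (q : PForm 1) (c : ℂ), c ≠ 0 ∧
      (frameMap (isHomogeneous_linForm α β) (isHomogeneous_linForm γ δ) y :
        MvPolynomial (Fin 2) ℂ) = C c * ((p.rep : MvPolynomial (Fin 2) ℂ) ^ (3 - (i : ℕ)) *
          (q.rep : MvPolynomial (Fin 2) ℂ) ^ ((i : ℕ) + 1))) ↔
      ∃ (s : Fin 2 → ℂ) (c : ℂ), y = c • fun j => eval s (curveParam i j) := by
  have key : ∀ s : Fin 2 → ℂ, (frameMap (isHomogeneous_linForm α β) (isHomogeneous_linForm γ δ)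
      (fun j => eval s (curveParam i j)) : MvPolynomial (Fin 2) ℂ) =
      C (![6, 6, 12] i) * (linForm α β ^ (3 - (i : ℕ)) *
        (C (s 0) * linForm α β + C (s 1) * linForm γ δ) ^ ((i : ℕ) + 1)) := fun s => by
    refine MvPolynomial.funext fun x => ?_
    fin_cases i <;> simp [coe_frameMap, frameCubic, curveParam] <;> ring
  have hκ : (![6, 6, 12] i : ℂ) ≠ 0 := by fin_cases i <;> simp
  rw [hp]
  constructor
  · rintro ⟨q, c, hc, h⟩
    obtain ⟨b, hb⟩ := exists_expansion hdet q.rep.isHomogeneous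
    refine ⟨b, c / ![6, 6, 12] i, frameMap_injective hdet (Subtype.ext ?_)⟩
    rw [map_smul, h]
    change _ = _ • (frameMap _ _ _ : MvPolynomial (Fin 2) ℂ)
    rw [key, smul_eq_C_mul, ← mul_assoc (C _) (C _), ← C_mul, div_mul_cancel₀ _ hκ, hb, Fin.sum_univ_two]
    simp
  · rintro ⟨s, c, rfl⟩
    let l : BinForm 1 := ⟨C (s 0) * linForm α β + C (s 1) * linForm γ δ,
      (mem_homogeneousSubmodule _ _).2 (((isHomogeneous_linForm α β).C_mul _).add
        ((isHomogeneous_linForm γ δ).C_mul _))⟩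
    have hval : (frameMap (isHomogeneous_linForm α β) (isHomogeneous_linForm γ δ)
        (c • fun j => eval s (curveParam i j)) : MvPolynomial (Fin 2) ℂ) =
        C (c * ![6, 6, 12] i) * (linForm α β ^ (3 - (i : ℕ)) *
          (l : MvPolynomial (Fin 2) ℂ) ^ ((i : ℕ) + 1)) := by
      rw [map_smul]
      change c • (frameMap _ _ _ : MvPolynomial (Fin 2) ℂ) = _
      rw [key, smul_eq_C_mul, C_mul, mul_assoc]
    have hne : frameMap (isHomogeneous_linForm α β) (isHomogeneous_linForm γ δ)
        (c • fun j => eval s (curveParam i j)) ≠ 0 :=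
      (map_ne_zero_iff _ (frameMap_injective hdet)).2 hy
    have hl : l ≠ 0 := by
      intro hl
      refine hne (Subtype.ext ?_)
      rw [hval, hl]
      simp
    have hc : c ≠ 0 := by
      rintro rfl
      simp at hy
    -- The chosen representative of `[l]` is `a • l`; the factor `a^(i+1)` is compensated in the
    -- constant.
    obtain ⟨a, ha⟩ := Projectivization.exists_smul_eq_mk_rep ℂ l hl
    refine ⟨Projectivization.mk ℂ l hl, c * ![6, 6, 12] i * ((a : ℂ) ^ ((i : ℕ) + 1))⁻¹,
      mul_ne_zero (mul_ne_zero hc hκ) (inv_ne_zero (pow_ne_zero _ a.ne_zero)), ?_⟩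
    rw [hval, ← ha]
    change _ = _ * (_ * ((a : ℂ) • (l : MvPolynomial (Fin 2) ℂ)) ^ _)
    rw [smul_pow, mul_smul_comm, smul_eq_C_mul, ← mul_assoc (C _) (C _), ← C_mul, mul_assoc,
      mul_assoc, inv_mul_cancel₀ (pow_ne_zero _ a.ne_zero), mul_one]

/-! ### The invariants in adapted coordinates -/

theorem quarticCoords_ofCoeffs {F : BinForm 4} {A : Fin 5 → ℂ}
    (h : (F : MvPolynomial (Fin 2) ℂ) = ofCoeffs fun i : Fin 5 => (Nat.choose 4 i : ℂ) * A i) :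
    quarticCoords F = A := by
  funext i
  have hi : (Nat.choose 4 i : ℂ) ≠ 0 := Nat.cast_ne_zero.2 (Nat.choose_pos (by omega)).ne'
  change (Nat.choose 4 i : ℂ)⁻¹ * coeff (binExp 4 i) (F : MvPolynomial (Fin 2) ℂ) = A i
  rw [h, coeff_ofCoeffs, inv_mul_cancel_left₀ hi]

/-- The coordinates of a quartic form after a linear substitution. -/
def quarticTransform (α β γ δ b₀ b₁ b₂ b₃ : ℂ) : Fin 5 → ℂ :=
  ![b₀ * α ^ 4 + 4 * b₁ * (α ^ 3 * γ) + 6 * b₂ * (α ^ 2 * γ ^ 2) + 4 * b₃ * (α * γ ^ 3),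
    b₀ * (α ^ 3 * β) + b₁ * (3 * α ^ 2 * β * γ + α ^ 3 * δ) +
      3 * b₂ * (α * β * γ ^ 2 + α ^ 2 * γ * δ) + b₃ * (β * γ ^ 3 + 3 * α * γ ^ 2 * δ),
    b₀ * (α ^ 2 * β ^ 2) + 2 * b₁ * (α ^ 2 * β * δ + α * β ^ 2 * γ) +
      b₂ * (α ^ 2 * δ ^ 2 + 4 * α * β * γ * δ + β ^ 2 * γ ^ 2) +
      2 * b₃ * (γ ^ 2 * δ * β + γ * δ ^ 2 * α),
    b₀ * (β ^ 3 * α) + b₁ * (3 * β ^ 2 * α * δ + β ^ 3 * γ) +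
      3 * b₂ * (β * α * δ ^ 2 + β ^ 2 * δ * γ) + b₃ * (α * δ ^ 3 + 3 * β * δ ^ 2 * γ),
    b₀ * β ^ 4 + 4 * b₁ * (β ^ 3 * δ) + 6 * b₂ * (β ^ 2 * δ ^ 2) + 4 * b₃ * (β * δ ^ 3)]

/-- Dividing the weights 3, 6, 6, 4 of `frameCubic` by the binomial coefficients 1, 4, 6, 4 gives
the arguments `3y₂`, `(3/2)y₁`, `y₀`, `y₃`. -/
theorem quarticCoords_frameMap (y : Fin 4 → ℂ) :
    quarticCoords (frameMap (isHomogeneous_linForm α β) (isHomogeneous_linForm γ δ) y) =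
      quarticTransform α β γ δ (3 * y 2) (3 / 2 * y 1) (y 0) (y 3) := by
  refine quarticCoords_ofCoeffs ?_
  rw [coe_frameMap, ofCoeffs_eq]
  refine MvPolynomial.funext fun x => ?_
  have h2 : Nat.choose 4 2 = 6 := rfl
  simp [frameCubic, eval_linForm, Fin.sum_univ_five, quarticTransform, h2]
  ring

/-- Invariance of `Q` under substitutions, with weight 4 in the determinant; since the form is
divisible by `v`, the coefficient `b₄` is zero. The catalecticant below behaves likewise, with
weight 6. -/
theorem eval_invQ_quarticTransform (α β γ δ b₀ b₁ b₂ b₃ : ℂ) :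
    eval (quarticTransform α β γ δ b₀ b₁ b₂ b₃) invQ =
      (α * δ - β * γ) ^ 4 * (3 * b₂ ^ 2 - 4 * b₁ * b₃) := by
  simp [invQ, quarticTransform]
  ring

theorem eval_invC_quarticTransform (α β γ δ b₀ b₁ b₂ b₃ : ℂ) :
    eval (quarticTransform α β γ δ b₀ b₁ b₂ b₃) invC =
      (α * δ - β * γ) ^ 6 * (2 * b₁ * b₂ * b₃ - b₀ * b₃ ^ 2 - b₂ ^ 3) := by
  simp [invC, quarticTransform]
  ring

/-- The invariant `Q` on the osculating hyperplane. -/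
def restrictedQ : MvPolynomial (Fin 4) ℂ := 3 * X 0 ^ 2 - 6 * (X 1 * X 3)

/-- The invariant `C` on the osculating hyperplane. -/
def restrictedC : MvPolynomial (Fin 4) ℂ :=
  3 * (X 0 * X 1 * X 3) - 3 * (X 2 * X 3 ^ 2) - X 0 ^ 3

/-- The central computation: the plane splits off and the standard form remains. The normalization
of the coordinates in `frameCubic` makes this equality hold without further rescaling. -/
theorem pencilForm_restricted :
    pencilForm restrictedC restrictedQ = (18 * X 3 : MvPolynomial (Fin 4) ℂ) • exceptionalForm := by
  have hc : ∀ (k : ℕ) [k.AtLeastTwo] (i : Fin 4),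
      pderiv i (OfNat.ofNat k : MvPolynomial (Fin 4) ℂ) = 0 := fun k _ i => by
    rw [← map_ofNat C k, pderiv_C]
  funext i
  fin_cases i <;>
    simp [pencilForm, restrictedC, restrictedQ, exceptionalForm, differential, pderiv_X, hc,
      Derivation.leibniz, Derivation.leibniz_pow] <;> ring

theorem pullback_omega (hdet : α * δ - β * γ = 1) {φ : (Fin 4 → ℂ) →ₗ[ℂ] BinForm 4}
    {g : (Fin 4 → ℂ) ≃ₗ[ℂ] (Fin 4 → ℂ)} (hφ : ∀ x, φ x =
      frameMap (isHomogeneous_linForm α β) (isHomogeneous_linForm γ δ) (g x)) :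
    pullback (quarticCoords ∘ₗ φ) omega =
      planeForm g • pullback (g : (Fin 4 → ℂ) →ₗ[ℂ] (Fin 4 → ℂ)) exceptionalForm := by
  have hC : subst (quarticCoords ∘ₗ φ) invC = subst (g : (Fin 4 → ℂ) →ₗ[ℂ] _) restrictedC :=
    MvPolynomial.funext fun x => by
      rw [eval_subst, eval_subst, LinearMap.comp_apply, hφ, quarticCoords_frameMap,
        eval_invC_quarticTransform, hdet]
      simp [restrictedC]
      ring
  have hQ : subst (quarticCoords ∘ₗ φ) invQ = subst (g : (Fin 4 → ℂ) →ₗ[ℂ] _) restrictedQ :=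
    MvPolynomial.funext fun x => by
      rw [eval_subst, eval_subst, LinearMap.comp_apply, hφ, quarticCoords_frameMap,
        eval_invQ_quarticTransform, hdet]
      simp [restrictedQ]
      ring
  change pullback _ (pencilForm invC invQ) = _
  rw [pullback_pencilForm, hC, hQ, ← pullback_pencilForm, pencilForm_restricted, pullback_smul,
    planeForm]

end Frame

/-! ### The zeros of the restricted form -/

section Zeros

variable (g : (Fin 4 → ℂ) ≃ₗ[ℂ] (Fin 4 → ℂ))

theorem pullback_symm_pullback (ω : OneForm 4) :
    pullback (g.symm : (Fin 4 → ℂ) →ₗ[ℂ] (Fin 4 → ℂ))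
      (pullback (g : (Fin 4 → ℂ) →ₗ[ℂ] (Fin 4 → ℂ)) ω) = ω := by
  rw [pullback_pullback, LinearEquiv.comp_coe, LinearEquiv.symm_trans_self,
    LinearEquiv.refl_toLinearMap, pullback_id]

theorem pullback_const_smul {m n : ℕ} (L : (Fin m → ℂ) →ₗ[ℂ] (Fin n → ℂ)) (c : ℂ)
    (ω : OneForm n) : pullback L (c • ω) = c • pullback L ω := by
  funext j
  simp [pullback_apply, Finset.smul_sum]

theorem isHomogeneous_pullback {m n d : ℕ} (L : (Fin m → ℂ) →ₗ[ℂ] (Fin n → ℂ)) {ω : OneForm n}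
    (hω : ∀ i, (ω i).IsHomogeneous d) (j : Fin m) : (pullback L ω j).IsHomogeneous d := by
  rw [pullback_apply]
  refine IsHomogeneous.sum _ _ _ fun i _ => ?_
  rw [mul_comm]
  exact ((hω i).subst L).C_mul _

theorem eval_pullback_eq_zero {m n : ℕ} (L : (Fin m → ℂ) →ₗ[ℂ] (Fin n → ℂ)) {ω : OneForm n}
    {v : Fin m → ℂ} (h : ∀ i, eval (L v) (ω i) = 0) (j : Fin m) :
    eval v (pullback L ω j) = 0 := by
  rw [pullback_apply, map_sum]
  exact Finset.sum_eq_zero fun i _ => by rw [map_mul, eval_subst, h i, zero_mul]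

theorem eval_pullback_eq_zero_iff {ω : OneForm 4} (v : Fin 4 → ℂ) :
    (∀ j, eval v (pullback (g : (Fin 4 → ℂ) →ₗ[ℂ] (Fin 4 → ℂ)) ω j) = 0) ↔
      ∀ i, eval (g v) (ω i) = 0 := by
  refine ⟨fun h i => ?_, fun h => eval_pullback_eq_zero _ h⟩
  rw [← pullback_symm_pullback g ω]
  exact eval_pullback_eq_zero _ (by simpa using h) i

theorem mk_mem_formZeros {n d : ℕ} {ω : OneForm n} (hω : ∀ i, (ω i).IsHomogeneous d)
    {v : Fin n → ℂ} (hv : v ≠ 0) :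
    Projectivization.mk ℂ v hv ∈ formZeros ω ↔ ∀ i, eval v (ω i) = 0 := by
  rw [formZeros, mk_mem_projZeros (by rintro _ ⟨i, rfl⟩; exact ⟨d, hω i⟩)]
  exact Set.forall_mem_range

theorem isHomogeneous_const_smul_pullback (c : ℂ) (i : Fin 4) :
    ((c • pullback (g : (Fin 4 → ℂ) →ₗ[ℂ] (Fin 4 → ℂ)) exceptionalForm) i).IsHomogeneous 3 := by
  rw [Pi.smul_apply, smul_eq_C_mul]
  exact (isHomogeneous_pullback _ isHomogeneous_exceptionalForm i).C_mul c

theorem formZeros_const_smul_pullback {c : ℂ} (hc : c ≠ 0) :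
    formZeros (c • pullback (g : (Fin 4 → ℂ) →ₗ[ℂ] (Fin 4 → ℂ)) exceptionalForm) =
      ⋃ i, projMap g ⁻¹' projZeros (curveEqs i) := by
  ext x
  induction x using Projectivization.ind with
  | h v hv =>
  rw [mk_mem_formZeros (isHomogeneous_const_smul_pullback g c)]
  simp only [Pi.smul_apply, smul_eval, mul_eq_zero, hc, false_or, eval_pullback_eq_zero_iff,
    Set.mem_iUnion, Set.mem_preimage, projMap_mk]
  exact eval_exceptionalForm_eq_zero_iff _

theorem isHomogeneous_planeForm_smul (i : Fin 4) :
    ((planeForm g • pullback (g : (Fin 4 → ℂ) →ₗ[ℂ] (Fin 4 → ℂ)) exceptionalForm)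
      i).IsHomogeneous 4 :=
  (isHomogeneous_planeForm g).mul (isHomogeneous_pullback _ isHomogeneous_exceptionalForm i)

/-- The line and the conic lie in the plane, so only the plane and the twisted cubic remain. -/
theorem formZeros_planeForm_smul :
    formZeros (planeForm g • pullback (g : (Fin 4 → ℂ) →ₗ[ℂ] (Fin 4 → ℂ)) exceptionalForm) =
      ⋃ i : Fin 2, projMap g ⁻¹' ![projZeros {X (3 : Fin 4)}, projZeros (curveEqs 2)] i := by
  ext x
  induction x using Projectivization.ind with
  | h v hv =>
  have hgv : g v ≠ 0 := by simpa using hv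
  have h1 : (∀ i, eval v ((planeForm g •
      pullback (g : (Fin 4 → ℂ) →ₗ[ℂ] (Fin 4 → ℂ)) exceptionalForm) i) = 0) ↔
      g v 3 = 0 ∨ ∃ i, Projectivization.mk ℂ (g v) hgv ∈ projZeros (curveEqs i) := by
    rw [← eval_exceptionalForm_eq_zero_iff, ← eval_pullback_eq_zero_iff, ← forall_or_left]
    simp [planeForm, eval_subst]
  rw [mk_mem_formZeros (isHomogeneous_planeForm_smul g), h1, Set.mem_iUnion, Fin.exists_fin_two,
    Fin.exists_fin_succ, Fin.exists_fin_succ, Fin.exists_fin_one, Set.mem_preimage,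
    Set.mem_preimage, projMap_mk]
  simp only [Fin.succ_zero_eq_one, Fin.succ_one_eq_two, Matrix.cons_val_zero, Matrix.cons_val_one,
    mk_mem_plane, mk_mem_line, mk_mem_conic]
  tauto

theorem projMap_surjective : Function.Surjective (projMap g) := fun x =>
  ⟨projMap g.symm x, projMap_projMap_symm g x⟩

theorem formZerosOfDim_const_smul_pullback {c : ℂ} (hc : c ≠ 0) (k : ℕ) :
    formZerosOfDim k (c • pullback (g : (Fin 4 → ℂ) →ₗ[ℂ] (Fin 4 → ℂ)) exceptionalForm) =
      ⋃ i, ⋃ (_ : 1 = k), projMap g ⁻¹' projZeros (curveEqs i) := by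
  rw [formZerosOfDim, formZeros_const_smul_pullback g hc]
  refine sUnion_isIrredComponent_iUnion (d := fun _ => 1)
    (fun i => (isIrreducibleAlgebraic_curve i).preimage g) (fun i j h => ?_)
    (fun i => (hasDim_curve i).preimage g) k
  rw [(projMap_surjective g).preimage_subset_preimage_iff] at h
  exact curve_subset_curve i j h

theorem formZerosOfDim_two_planeForm_smul :
    formZerosOfDim 2 (planeForm g •
      pullback (g : (Fin 4 → ℂ) →ₗ[ℂ] (Fin 4 → ℂ)) exceptionalForm) =
      projMap g ⁻¹' projZeros {X (3 : Fin 4)} := by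
  rw [formZerosOfDim, formZeros_planeForm_smul,
    sUnion_isIrredComponent_iUnion (d := ![2, 1]) ?_ ?_ ?_ 2]
  · ext x
    simp [Fin.exists_fin_two]
  · intro i
    refine IsIrreducibleAlgebraic.preimage ?_ g
    fin_cases i
    · exact isIrreducibleAlgebraic_plane
    · exact isIrreducibleAlgebraic_curve 2
  · intro i j h
    rw [(projMap_surjective g).preimage_subset_preimage_iff] at h
    fin_cases i <;> fin_cases j
    · rfl
    · exact absurd h not_plane_subset_cubic
    · exact absurd h not_cubic_subset_plane
    · rfl
  · intro i
    refine HasDim.preimage ?_ g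
    fin_cases i
    · exact hasDim_plane
    · exact hasDim_curve 2

/-! ### The reduced form defines the exceptional foliation -/

theorem planeForm_smul_eq_pencilForm :
    planeForm g • pullback (g : (Fin 4 → ℂ) →ₗ[ℂ] (Fin 4 → ℂ)) exceptionalForm =
      pencilForm (subst (g : (Fin 4 → ℂ) →ₗ[ℂ] (Fin 4 → ℂ)) restrictedC)
        (subst (g : (Fin 4 → ℂ) →ₗ[ℂ] (Fin 4 → ℂ)) restrictedQ) := by
  rw [planeForm, ← pullback_smul, ← pencilForm_restricted, pullback_pencilForm]

theorem isHomogeneous_restrictedQ : restrictedQ.IsHomogeneous 2 :=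
  (isHomogeneous_X_sq _).ofNat_mul.sub (isHomogeneous_X_mul_X _ _).ofNat_mul

theorem isHomogeneous_restrictedC : restrictedC.IsHomogeneous 3 :=
  (((isHomogeneous_X_mul_X _ _).mul (isHomogeneous_X _ _)).ofNat_mul.sub
    (isHomogeneous_X_mul (isHomogeneous_X_sq _) _).ofNat_mul).sub (isHomogeneous_X_pow _ _)

/-- Integrability and the radial equation are inherited from the pencil form by cancelling the
linear factor; all components of the zero set are curves, so none has codimension one. -/
theorem definesFoliation_const_smul_pullback {c : ℂ} (hc : c ≠ 0) :
    DefinesFoliation 3 2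
      (c • pullback (g : (Fin 4 → ℂ) →ₗ[ℂ] (Fin 4 → ℂ)) exceptionalForm) := by
  have hω := planeForm_smul_eq_pencilForm g
  have hF : planeForm g * C c⁻¹ ≠ 0 :=
    mul_ne_zero (planeForm_ne_zero g) (by simpa using hc)
  have hmul : ∀ i, pencilForm (subst (g : (Fin 4 → ℂ) →ₗ[ℂ] (Fin 4 → ℂ)) restrictedC)
      (subst (g : (Fin 4 → ℂ) →ₗ[ℂ] (Fin 4 → ℂ)) restrictedQ) i = planeForm g * C c⁻¹ *
      (c • pullback (g : (Fin 4 → ℂ) →ₗ[ℂ] (Fin 4 → ℂ)) exceptionalForm) i := fun i => by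
    rw [← hω, Pi.smul_apply, Pi.smul_apply, smul_eq_mul, smul_eq_C_mul, mul_assoc,
      ← mul_assoc (C _), ← C_mul, inv_mul_cancel₀ hc, C_1, one_mul]
  refine ⟨?_, isHomogeneous_const_smul_pullback g c, ?_, ?_, ?_⟩
  · intro h
    have h1 := (smul_eq_zero.1 h).resolve_left hc
    have h2 := (eval_pullback_eq_zero_iff g (ω := exceptionalForm) (g.symm ![1, 0, 0, 1])).1
      (by simp [h1]) 2
    simp [exceptionalForm] at h2
  · have := radial_pencilForm (isHomogeneous_restrictedC.subst (g : (Fin 4 → ℂ) →ₗ[ℂ] _))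
      (isHomogeneous_restrictedQ.subst (g : (Fin 4 → ℂ) →ₗ[ℂ] _))
    simp only [hmul, mul_assoc (planeForm g * C c⁻¹), ← Finset.mul_sum] at this
    exact (mul_eq_zero.1 this).resolve_left hF
  · exact IsIntegrable.of_mul hF hmul (isIntegrable_pencilForm _ _)
  · intro k hk
    rw [formZerosOfDim_const_smul_pullback g hc]
    have : 1 ≠ k := by omega
    simp [this]

theorem isExceptional_const_smul_pullback {c : ℂ} (hc : c ≠ 0) :
    IsExceptional (c • pullback (g : (Fin 4 → ℂ) →ₗ[ℂ] (Fin 4 → ℂ)) exceptionalForm) :=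
  ⟨g.symm, c, hc, by rw [pullback_const_smul, pullback_symm_pullback]⟩

end Zeros

/-! ### Images in the space of quartic forms -/

/-- The three curves of zeros, in the space of quartic forms. -/
def curveAt (p : PForm 1) : Fin 3 → Set (PForm 4) :=
  ![osculatingPlane 4 1 p, conicAt p, cubicAt p]

theorem mk_mem_curveAt (p : PForm 1) (i : Fin 3) {F : BinForm 4} (hF : F ≠ 0) :
    Projectivization.mk ℂ F hF ∈ curveAt p i ↔ ∃ (q : PForm 1) (c : ℂ), c ≠ 0 ∧
      (F : MvPolynomial (Fin 2) ℂ) = C c * ((p.rep : MvPolynomial (Fin 2) ℂ) ^ (3 - (i : ℕ)) *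
        (q.rep : MvPolynomial (Fin 2) ℂ) ^ ((i : ℕ) + 1)) := by
  fin_cases i
  · change _ ∈ osculatingPlane 4 1 p ↔ _
    rw [osculatingPlane_one_eq]
    refine exists_congr fun q => (mk_eq_divisor_iff hF _).trans (exists_congr fun c => ?_)
    refine and_congr_right fun _ => Eq.congr rfl ?_
    simp only [Fin.prod_univ_four, Matrix.cons_val]
    ring
  · refine exists_congr fun q => (mk_eq_divisor_iff hF _).trans (exists_congr fun c => ?_)
    refine and_congr_right fun _ => Eq.congr rfl ?_
    simp only [Fin.prod_univ_four, Matrix.cons_val]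
    ring
  · refine exists_congr fun q => (mk_eq_divisor_iff hF _).trans (exists_congr fun c => ?_)
    refine and_congr_right fun _ => Eq.congr rfl ?_
    simp only [Fin.prod_univ_four, Matrix.cons_val]
    ring

theorem curveAt_subset (p : PForm 1) (i : Fin 3) : curveAt p i ⊆ osculatingPlane 4 3 p := by
  rw [osculatingPlane_three_eq]
  fin_cases i
  · change osculatingPlane 4 1 p ⊆ _
    rw [osculatingPlane_one_eq]
    rintro x ⟨q, rfl⟩
    exact ⟨p, p, q, rfl⟩
  · rintro x ⟨q, rfl⟩
    exact ⟨p, q, q, rfl⟩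
  · rintro x ⟨q, rfl⟩
    exact ⟨q, q, q, rfl⟩

/-- The map induced by `φ` is injective with image the hyperplane, so a subset `T` of the hyperplane
can be compared with `A` point by point. -/
theorem image_map_eq {p : PForm 1} {φ : (Fin 4 → ℂ) →ₗ[ℂ] BinForm 4} (hφ : Function.Injective φ)
    (hrange : LinearMap.range φ = osculatingSpace 4 3 p) {A : Set (ℙ ℂ (Fin 4 → ℂ))}
    {T : Set (PForm 4)} (hT : T ⊆ osculatingPlane 4 3 p)
    (h : ∀ v (hv : v ≠ 0), Projectivization.mk ℂ v hv ∈ A ↔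
      Projectivization.mk ℂ (φ v) ((map_ne_zero_iff φ hφ).2 hv) ∈ T) :
    Projectivization.map φ hφ '' A = T := by
  ext x
  constructor
  · rintro ⟨y, hy, rfl⟩
    induction y using Projectivization.ind with
    | h v hv => exact (h v hv).1 hy
  · intro hx
    have h1 : x.rep ∈ LinearMap.range φ := hrange ▸ hT hx
    obtain ⟨v, hv⟩ := h1
    have hv0 : v ≠ 0 := by
      rintro rfl
      exact x.rep_nonzero (by rw [← hv, map_zero])
    have hmk : Projectivization.mk ℂ (φ v) ((map_ne_zero_iff φ hφ).2 hv0) = x := by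
      conv_rhs => rw [← x.mk_rep]
      simp only [hv]
    exact ⟨Projectivization.mk ℂ v hv0, (h v hv0).2 (hmk ▸ hx), hmk⟩

end

end QuarticFoliation

/-! ### Assembly in arbitrary linear coordinates on the hyperplane. -/

theorem mainTheorem3 (p : PForm 1) (φ : (Fin 4 → ℂ) →ₗ[ℂ] BinForm 4)
    (hφ : Function.Injective φ) (hrange : LinearMap.range φ = osculatingSpace 4 3 p) :
    -- the osculating flag is a line, a plane and a hyperplane, described by divisors
    (∀ k ≤ 3, Module.finrank ℂ (osculatingSpace 4 k p) = k + 1) ∧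
    osculatingPlane 4 1 p = {x | ∃ q, x = divisor ![p, p, p, q]} ∧
    osculatingPlane 4 2 p = {x | ∃ q r, x = divisor ![p, p, q, r]} ∧
    osculatingPlane 4 3 p = {x | ∃ q r s, x = divisor ![p, q, r, s]} ∧
    -- `X_2` is a conic in the osculating plane, `X_3` is a twisted cubic in the hyperplane
    (∃ (f : BinForm 2 →ₗ[ℂ] BinForm 4) (hf : Function.Injective f),
      LinearMap.range f = osculatingSpace 4 2 p ∧
      conicAt p = Projectivization.map f hf '' veroneseCurve 2) ∧
    (∃ (f : BinForm 3 →ₗ[ℂ] BinForm 4) (hf : Function.Injective f),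
      LinearMap.range f = osculatingSpace 4 3 p ∧
      cubicAt p = Projectivization.map f hf '' veroneseCurve 3) ∧
    -- the zeros in codimension one of the restriction of `ω` to `H`
    Projectivization.map φ hφ '' formZerosOfDim 2 (pullback (quarticCoords ∘ₗ φ) omega) =
      osculatingPlane 4 2 p ∧
    -- the reduced form exists; whatever choice is made, it has the stated properties
    (∃ F η, IsReduction (pullback (quarticCoords ∘ₗ φ) omega) F η) ∧
    ∀ F η, IsReduction (pullback (quarticCoords ∘ₗ φ) omega) F η →
      F.IsHomogeneous 1 ∧
      Projectivization.map φ hφ '' projZeros {F} = osculatingPlane 4 2 p ∧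
      Projectivization.map φ hφ '' formZeros η =
        osculatingPlane 4 1 p ∪ conicAt p ∪ cubicAt p ∧
      formZerosOfDim 1 η = formZeros η ∧
      DefinesFoliation 3 2 η ∧
      IsExceptional η := by
  obtain ⟨α, β, γ, δ, hdet, hp⟩ := exists_frame p.rep_nonzero
  let ψ := frameMap (isHomogeneous_linForm α β) (isHomogeneous_linForm γ δ)
  have hψ : Function.Injective ψ := frameMap_injective hdet
  have hψr : LinearMap.range φ = LinearMap.range ψ := hrange.trans (range_frameMap hdet hp).symm
  -- `φ` and the frame coordinates `ψ` have the same range, so `g = ψ⁻¹ ∘ φ` is the change between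
  -- them.
  let g : (Fin 4 → ℂ) ≃ₗ[ℂ] (Fin 4 → ℂ) := (LinearEquiv.ofInjective φ hφ).trans
    ((LinearEquiv.ofEq _ _ hψr).trans (LinearEquiv.ofInjective ψ hψ).symm)
  have hg : ∀ x, φ x = ψ (g x) := fun x => by
    have : LinearEquiv.ofInjective ψ hψ (g x) =
        LinearEquiv.ofEq _ _ hψr (LinearEquiv.ofInjective φ hφ x) := by simp [g]
    exact (congrArg Subtype.val this).symm
  have hplane : ∀ v (hv : v ≠ 0), (g v) 3 = 0 ↔
      Projectivization.mk ℂ (φ v) ((map_ne_zero_iff φ hφ).2 hv) ∈ osculatingPlane 4 2 p :=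
    fun v hv => by
      rw [mk_mem_osculatingPlane_iff, hg]
      exact (frameMap_mem_osculatingSpace_two hdet hp (g v)).symm
  have hsub : osculatingPlane 4 2 p ⊆ osculatingPlane 4 3 p := by
    rw [osculatingPlane_two_eq, osculatingPlane_three_eq]
    rintro x ⟨q, r, rfl⟩
    exact ⟨p, q, r, rfl⟩
  rw [pullback_omega hdet hg]
  refine ⟨fun k hk => finrank_osculatingSpace (by omega) p, osculatingPlane_one_eq p,
    osculatingPlane_two_eq p, osculatingPlane_three_eq p, exists_conicAt_eq p,
    exists_cubicAt_eq p, ?_, ⟨_, _, isReduction_planeForm g⟩, ?_⟩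
  · rw [formZerosOfDim_two_planeForm_smul]
    refine image_map_eq hφ hrange hsub fun v hv => ?_
    rw [Set.mem_preimage, projMap_mk, mk_mem_plane, hplane v hv]
  · intro F η h
    obtain ⟨hF, c, hc, hFc, rfl⟩ := h.eq_planeForm
    refine ⟨hF, ?_, ?_, ?_, definesFoliation_const_smul_pullback g hc,
      isExceptional_const_smul_pullback g hc⟩
    · refine image_map_eq hφ hrange hsub fun v hv => ?_
      rw [mk_mem_projZeros (by simpa using ⟨1, hF⟩), ← hplane v hv]
      have := congrArg (MvPolynomial.eval v) hFc
      simp only [planeForm, eval_subst, map_mul, MvPolynomial.eval_C, MvPolynomial.eval_X,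
        map_ofNat] at this
      simp only [Set.mem_singleton_iff, forall_eq]
      constructor
      · intro h0
        simpa [h0] using this
      · intro h0
        simpa [h0, hc] using this
    · have hunion : osculatingPlane 4 1 p ∪ conicAt p ∪ cubicAt p = ⋃ i, curveAt p i := by
        ext x
        rw [Set.mem_iUnion, Fin.exists_fin_succ, Fin.exists_fin_succ, Fin.exists_fin_one]
        exact or_assoc
      rw [formZeros_const_smul_pullback g hc, hunion, Set.image_iUnion]
      refine Set.iUnion_congr fun i => ?_
      refine image_map_eq hφ hrange (curveAt_subset p i) fun v hv => ?_
      have hgv : g v ≠ 0 := by simpa using hv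
      -- Both sides become the same condition: `ψ (g v)` is a multiple of `v^(3-i)` times an
      -- `(i+1)`-st power of a linear form.
      rw [Set.mem_preimage, projMap_mk, projZeros_curveEqs, mk_mem_paramSet,
        ← exists_frameMap_eq_iff hdet hp i hgv, mk_mem_curveAt, hg]
    · rw [formZerosOfDim_const_smul_pullback g hc, formZeros_const_smul_pullback g hc]
      simp
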